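/- **Setting.** Let $d\in\mathbb N$, $L>0$, $\Lambda_L=[-L/2,L/2)^d$ with volume $|\Lambda_L|$, and let $\Lambda_L^*=(\tfrac1L\mathbb Z)^d$. For $h:\mathbb R^d\to\mathbb C$ let $h_\#$ be the $L$-periodic extension of $h|_{\Lambda_L}$ to $\mathbb R^d$. For $f\in L^1(\Lambda_L)$ and $p\in\Lambda_L^*$ put $\widehat f(p)=\int_{\Lambda_L}e^{-2\pi i p\cdot x}f(x)\,dx$; in particular $\widehat h_\#(p)=\int_{\Lambda_L}e^{-2\pi i p\cdot x}h_\#(x)\,dx$. For $m\ge 1$ write $\int_{(\Lambda_L^*)^m}f(k)\,dk=|\Lambda_L|^{-m}\sum_{k\in(\Lambda_L^*)^m}f(k)$. Let $\nu(p)=\tfrac12|p|^2$. Let $-\Delta_L$ be the periodic Laplacian on $L^2(\Lambda_L)$, with domain $\{f:\nu\widehat f\in\ell^2(\Lambda_L^*)\}$ and $\widehat{-\Delta_L f}(p)=2(2\pi)^2\nu(p)\widehat f(p)=(2\pi)^2|p|^2\widehat f(p)$. For $z\in\mathbb C\setminus[0,\infty)$ let $$R_L(z)=\Big(-\tfrac{1}{2(2\pi)^2}\Delta_L-z\Big)^{-1}.$$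 Let $B:\mathbb R^d\to\mathbb R$ be a Schwartz function which has compact support or is invariant under each coordinate reflection $(x_1,\dots,x_j,\dots,x_d)\mapsto(x_1,\dots,-x_j,\dots,x_d)$. Let $\mathbf P_v$ be a probability measure on $\mathbb R$ all of whose moments $m_k=\int v^k\,d\mathbf P_v(v)$, $k\in\mathbb N$, are finite (i.e. $\int |v|^k\,d\mathbf P_v<\infty$). Let $M$ be a Poisson random variable with mean $|\Lambda_L|$, let $y_1,y_2,\dots$ be i.i.d. uniformly distributed on $\Lambda_L$, let $v_1,v_2,\dots$ be i.i.d. with law $\mathbf P_v$, all independent; denote by $\mathbf E_L$ the expectation with respect to their joint law, and let $V_L$ be the operator of multiplication by the random potential $$V_{L}(x)=\sum_{\gamma=1}^{M}v_\gamma\,B_\#(x-y_\gamma).$$ For $n\ge 0$ let $\mathcal A_n$ be the set of all partitions of $\{1,\dots,n\}$ into non-empty blocks (with $\mathcal A_0=\{\emptyset\}$), let $\delta_{*,L}(u)=|\Lambda_L|$ if $u=0$ and $\delta_{*,L}(u)=0$ otherwise, and for $A\in\mathcal A_n$ and $k=(k_1,\dots,k_{n+1})\in(\Lambda_L^*)^{n+1}$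 let $$\mathcal P_{A,L}(k)=\prod_{a\in A}\Big\{m_{|a|}\,\delta_{*,L}\Big(\sum_{l\in a}(k_l-k_{l+1})\Big)\prod_{l\in a}\widehat B_\#(k_l-k_{l+1})\Big\}.$$ **Theorem.** Let $n\ge0$, $z\in\mathbb C\setminus[0,\infty)$ and $\psi_1,\psi_2\in L^2(\mathbb R^d)$. Then the random variable $\langle\psi_{1,\#},R_L(z)[V_LR_L(z)]^n\psi_{2,\#}\rangle_{L^2(\Lambda_L)}$ (inner product conjugate linear in the first entry) is integrable, the sum over $(\Lambda_L^*)^{n+1}$ below converges absolutely, and $$T_{n,L}[z;\psi_1,\psi_2]:=\mathbf E_L\langle\psi_{1,\#},R_L(z)[V_LR_L(z)]^n\psi_{2,\#}\rangle_{L^2(\Lambda_L)}$$ satisfies $$T_{n,L}[z;\psi_1,\psi_2]=\int_{(\Lambda_L^*)^{n+1}}\sum_{A\in\mathcal A_n}\mathcal P_{A,L}(k)\;\overline{\widehat\psi_{1,\#}(k_1)}\;\widehat\psi_{2,\#}(k_{n+1})\prod_{j=1}^{n+1}(\nu(k_j)-z)^{-1}\,d(k_1,\dots,k_{n+1}).$$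 -/

import Mathlib

open MeasureTheory ProbabilityTheory
open scoped SchwartzMap

noncomputable section

namespace PoissonSchrodinger

/-- Euclidean space `ℝ^d`. -/
abbrev E (d : ℕ) := EuclideanSpace ℝ (Fin d)

/-- The half-open box `Λ_L = [-L/2, L/2)^d`. -/
def box (d : ℕ) (L : ℝ) : Set (E d) := {x | ∀ j, -(L / 2) ≤ x j ∧ x j < L / 2}

/-- The volume `|Λ_L|`. -/
def boxVol (d : ℕ) (L : ℝ) : ℝ := (volume : Measure (E d)).real (box d L)

/-- Lebesgue measure on the box. -/
abbrev boxMeasure (d : ℕ) (L : ℝ) : Measure (E d) := (volume : Measure (E d)).restrict (box d L)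

/-- The Hilbert space `L²(Λ_L)`. -/
abbrev L2Box (d : ℕ) (L : ℝ) := Lp ℂ 2 (boxMeasure d L)

/-- The dual lattice `Λ_L^* = (ℤ / L)^d`. -/
def dualLattice (d : ℕ) (L : ℝ) : Set (E d) := {k | ∀ j, ∃ m : ℤ, k j = (m : ℝ) / L}

/-- The representative in the box `[-L/2, L/2)^d` of `x` modulo `L ℤ^d`. -/
def wrap {d : ℕ} (L : ℝ) (x : E d) : E d :=
  WithLp.toLp 2 fun j => x j - L * (⌊x j / L + 1 / 2⌋ : ℝ)

/-- `h_#`, the `L`-periodic extension to `ℝ^d` of the restriction of `h` to the box. -/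
def periodize {d : ℕ} {α : Type*} (L : ℝ) (h : E d → α) : E d → α := fun x => h (wrap L x)

/-- The exponential `x ↦ exp (2 π i p · x)`. -/
def expo {d : ℕ} (p x : E d) : ℂ := Complex.exp (2 * Real.pi * Complex.I * (inner ℝ p x : ℝ))

/-- The Fourier coefficient `∫_{Λ_L} exp (-2 π i p · x) f x dx`. -/
def fourierCoeff {d : ℕ} (L : ℝ) (f : E d → ℂ) (p : E d) : ℂ :=
  ∫ x in box d L, Complex.exp (-(2 * Real.pi * Complex.I * (inner ℝ p x : ℝ))) * f x

/-- The normalized sum `∫_{(Λ_L^*)^m} f(k) dk = |Λ_L|^{-m} ∑_k f(k)`. -/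
def latticeIntegral {d : ℕ} (L : ℝ) {m : ℕ} (f : (Fin m → dualLattice d L) → ℂ) : ℂ :=
  ((boxVol d L : ℂ)⁻¹) ^ m * ∑' k, f k

/-- The energy function `ν(p) = p² / 2`. -/
def nu {d : ℕ} (p : E d) : ℝ := 1 / 2 * ‖p‖ ^ 2

lemma wrap_eq_self {d : ℕ} {L : ℝ} {x : E d} (hx : x ∈ box d L) : wrap L x = x := by
  ext j
  obtain ⟨h1, h2⟩ := hx j
  have hL : 0 < L := by linarith
  have : ⌊x j / L + 1 / 2⌋ = 0 := by
    rw [Int.floor_eq_zero_iff, Set.mem_Ico]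
    have e : x j / L + 1 / 2 = (x j + L / 2) / L := by field_simp
    rw [e]
    refine ⟨div_nonneg (by linarith) hL.le, ?_⟩
    rw [div_lt_one hL]
    linarith
  change x j - L * (⌊x j / L + 1 / 2⌋ : ℝ) = x j
  rw [this, Int.cast_zero, mul_zero, sub_zero]

lemma measurable_wrap {d : ℕ} (L : ℝ) : Measurable (wrap L : E d → E d) := by
  unfold wrap
  fun_prop

lemma measurableSet_box (d : ℕ) (L : ℝ) : MeasurableSet (box d L) := by
  have : box d L = ⋂ j, {x : E d | -(L / 2) ≤ x j ∧ x j < L / 2} := by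
    ext x; simp [box]
  rw [this]
  refine MeasurableSet.iInter fun j => ?_
  have hm : Measurable fun x : E d => x j := by fun_prop
  exact (measurableSet_le measurable_const hm).inter (measurableSet_lt hm measurable_const)

lemma volume_box_lt_top (d : ℕ) (L : ℝ) : (volume : Measure (E d)) (box d L) < ⊤ := by
  refine Bornology.IsBounded.measure_lt_top ?_
  refine (Metric.isBounded_closedBall (x := (0 : E d)) (r := √(∑ _j : Fin d, (L / 2) ^ 2))).subset ?_
  intro x hx
  rw [mem_closedBall_zero_iff, EuclideanSpace.norm_eq]
  refine Real.sqrt_le_sqrt (Finset.sum_le_sum fun j _ => ?_)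
  obtain ⟨h1, h2⟩ := hx j
  rw [Real.norm_eq_abs, sq_abs]
  nlinarith

instance isFiniteMeasure_boxMeasure (d : ℕ) (L : ℝ) : IsFiniteMeasure (boxMeasure d L) :=
  ⟨by simpa using volume_box_lt_top d L⟩

lemma memLp_expo {d : ℕ} (L : ℝ) (p : E d) : MemLp (expo p) 2 (boxMeasure d L) := by
  refine MemLp.of_bound (C := 1) ?_ (Filter.Eventually.of_forall fun x => ?_)
  · refine Continuous.aestronglyMeasurable ?_
    unfold expo
    fun_prop
  · simp [expo, Complex.norm_exp]

/-- The inverse Fourier transform `|Λ_L|⁻¹ ∑_p g(p) exp (2 π i p · x)`, as a sum converging in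
`L²(Λ_L)` for every square summable `g`. -/
def invFourier {d : ℕ} (L : ℝ) (g : dualLattice d L → ℂ) : L2Box d L :=
  ((boxVol d L : ℂ)⁻¹) • ∑' p : dualLattice d L, g p • (memLp_expo L (p : E d)).toLp (expo (p : E d))

/-- The domain of the periodic Laplacian: those `f ∈ L²(Λ_L)` such that `ν f̂` is square summable. -/
def laplacianDomain (d : ℕ) (L : ℝ) : Set (L2Box d L) :=
  {f | Memℓp (fun p : dualLattice d L => (nu (p : E d) : ℂ) * fourierCoeff L f p) 2}

/-- The periodic Laplacian `-Δ_L`: the Fourier multiplier with symbol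
`(2 π)² p² = 2 (2 π)² ν(p)`. -/
def negLaplacian {d : ℕ} {L : ℝ} (f : laplacianDomain d L) : L2Box d L :=
  invFourier L fun p =>
    ((2 * (2 * Real.pi) ^ 2 * nu (p : E d) : ℝ) : ℂ) * fourierCoeff L (f : L2Box d L) p

/-- The free Hamiltonian `-(ℏ²/2m) Δ_L` in units where `ℏ²/2m = 1 / (2 (2 π)²)`. -/
def freeHamiltonian {d : ℕ} {L : ℝ} (f : laplacianDomain d L) : L2Box d L :=
  (((1 / (2 * (2 * Real.pi) ^ 2) : ℝ)) : ℂ) • negLaplacian f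

instance nonempty_laplacianDomain (d : ℕ) (L : ℝ) : Nonempty (laplacianDomain d L) := by
  refine ⟨0, ?_⟩
  have h : ∀ p : E d, fourierCoeff L (0 : L2Box d L) p = 0 := by
    intro p
    unfold fourierCoeff
    have : (fun x : E d => Complex.exp (-(2 * Real.pi * Complex.I * (inner ℝ p x : ℝ))) *
        (0 : L2Box d L) x) =ᵐ[boxMeasure d L] fun _ => 0 := by
      filter_upwards [Lp.coeFn_zero ℂ 2 (boxMeasure d L)] with x hx
      rw [hx, Pi.zero_apply, mul_zero]
    rw [integral_congr_ae this, integral_zero]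
  simp only [laplacianDomain, Set.mem_ofPred_eq, h, mul_zero]
  exact zero_memℓp

/-- The free resolvent `R_L(z) = (-(ℏ²/2m) Δ_L - z)⁻¹` : the inverse of the map
`g ↦ -(ℏ²/2m) Δ_L g - z g` from the domain of the Laplacian to `L²(Λ_L)`. -/
def freeResolvent {d : ℕ} {L : ℝ} (z : ℂ) (f : L2Box d L) : L2Box d L :=
  (Function.invFun (fun g : laplacianDomain d L => freeHamiltonian g - z • (g : L2Box d L)) f :
    laplacianDomain d L)

/-- A configuration `(M, (y_γ), (v_γ))`: the number of impurities, their positions and their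
weights. Only the indices `γ < M` enter the potential. -/
abbrev Config (d : ℕ) := ℕ × (ℕ → E d) × (ℕ → ℝ)

/-- The joint law of `M`, `(y_γ)`, `(v_γ)`: `M` is Poisson with mean `|Λ_L|`, the `y_γ` are i.i.d.
uniform on the box, the `v_γ` are i.i.d. with law `Pv`, and all of them are independent. -/
def configLaw (d : ℕ) (L : ℝ) (Pv : Measure ℝ) : Measure (Config d) :=
  (poissonMeasure (boxVol d L).toNNReal).prod
    ((Measure.infinitePi fun _ : ℕ => ProbabilityTheory.cond (volume : Measure (E d)) (box d L)).prod
      (Measure.infinitePi fun _ : ℕ => Pv))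

/-- The random potential `V_{L,ω}(x) = ∫ B_#(x - y) dμ_{L,ω}(y) = ∑_{γ < M} v_γ B_#(x - y_γ)`, where
`μ_{L,ω} = ∑_{γ < M} v_γ δ_{y_γ}`. -/
def potential {d : ℕ} (L : ℝ) (B : 𝓢(E d, ℝ)) (ω : Config d) (x : E d) : ℝ :=
  ∑ γ ∈ Finset.range ω.1, ω.2.2 γ * periodize L B (x - ω.2.1 γ)

lemma measurable_potential {d : ℕ} (L : ℝ) (B : 𝓢(E d, ℝ)) (ω : Config d) :
    Measurable (potential L B ω) := by
  unfold potential periodize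
  refine Finset.measurable_sum _ fun γ _ => Measurable.const_mul ?_ _
  exact B.continuous.measurable.comp ((measurable_wrap L).comp (measurable_id.sub_const _))

lemma exists_bound_potential {d : ℕ} (L : ℝ) (B : 𝓢(E d, ℝ)) (ω : Config d) :
    ∃ C, ∀ x, ‖(potential L B ω x : ℂ)‖ ≤ C := by
  obtain ⟨C, hC⟩ := B.decay 0 0
  refine ⟨∑ γ ∈ Finset.range ω.1, |ω.2.2 γ| * C, fun x => ?_⟩
  rw [Complex.norm_real]
  refine (norm_sum_le _ _).trans (Finset.sum_le_sum fun γ _ => ?_)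
  rw [norm_mul, Real.norm_eq_abs]
  refine mul_le_mul_of_nonneg_left ?_ (abs_nonneg _)
  simpa [periodize] using hC.2 (wrap L (x - ω.2.1 γ))

lemma memLp_potential_mul {d : ℕ} {L : ℝ} (B : 𝓢(E d, ℝ)) (ω : Config d) (f : L2Box d L) :
    MemLp (fun x => (potential L B ω x : ℂ) * f x) 2 (boxMeasure d L) := by
  obtain ⟨C, hC⟩ := exists_bound_potential L B ω
  refine MemLp.of_le_mul (c := C) (Lp.memLp f) ?_ (Filter.Eventually.of_forall fun x => ?_)
  · exact ((measurable_potential L B ω).complex_ofReal.aestronglyMeasurable).mul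
      (Lp.aestronglyMeasurable f)
  · rw [norm_mul]
    exact mul_le_mul_of_nonneg_right (hC x) (norm_nonneg _)

/-- The operator on `L²(Λ_L)` of multiplication by the potential. -/
def potentialOp {d : ℕ} {L : ℝ} (B : 𝓢(E d, ℝ)) (ω : Config d) (f : L2Box d L) : L2Box d L :=
  (memLp_potential_mul B ω f).toLp fun x => (potential L B ω x : ℂ) * f x

lemma memLp_periodize {d : ℕ} (L : ℝ) (ψ : Lp ℂ 2 (volume : Measure (E d))) :
    MemLp (periodize L ψ) 2 (boxMeasure d L) := by
  refine MemLp.ae_eq ?_ ((Lp.memLp ψ).restrict (box d L))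
  filter_upwards [ae_restrict_mem (measurableSet_box d L)] with x hx
  simp [periodize, wrap_eq_self hx]

/-- `ψ_#` as an element of `L²(Λ_L)`, for `ψ ∈ L²(ℝ^d)`. -/
def periodizeL2 {d : ℕ} (L : ℝ) (ψ : Lp ℂ 2 (volume : Measure (E d))) : L2Box d L :=
  (memLp_periodize L ψ).toLp (periodize L ψ)

/-- The random variable `ω ↦ ⟨ψ₁_#, R_L(z) [V_{L,ω} R_L(z)]^n ψ₂_#⟩`, where the inner product is
conjugate linear in the first argument. -/
def matrixElement {d : ℕ} (L : ℝ) (B : 𝓢(E d, ℝ)) (n : ℕ) (z : ℂ)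
    (ψ₁ ψ₂ : Lp ℂ 2 (volume : Measure (E d))) (ω : Config d) : ℂ :=
  inner ℂ (periodizeL2 L ψ₁)
    (freeResolvent z ((fun f => potentialOp B ω (freeResolvent z f))^[n] (periodizeL2 L ψ₂)))

/-- The `n`-th expansion coefficient `T_{n,L}[z; ψ₁, ψ₂]`. -/
def expansionCoeff {d : ℕ} (L : ℝ) (B : 𝓢(E d, ℝ)) (Pv : Measure ℝ) (n : ℕ) (z : ℂ)
    (ψ₁ ψ₂ : Lp ℂ 2 (volume : Measure (E d))) : ℂ :=
  ∫ ω, matrixElement L B n z ψ₁ ψ₂ ω ∂(configLaw d L Pv)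

/-- The moment `m_k` of the weight distribution. -/
def weightMoment (Pv : Measure ℝ) (k : ℕ) : ℝ := ∫ v, v ^ k ∂Pv

open Classical in
/-- The normalized discrete delta function `δ_{*,L}(u) = |Λ_L| 1_{u = 0}`. -/
def deltaL {d : ℕ} (L : ℝ) (u : E d) : ℝ := if u = 0 then boxVol d L else 0

/-- The Fourier coefficient of `B_#`. -/
def profileCoeff {d : ℕ} (L : ℝ) (B : 𝓢(E d, ℝ)) (p : E d) : ℂ :=
  fourierCoeff L (periodize L fun x => (B x : ℂ)) p

/-- The partition function `𝒫_{A,L}(k)` of a set partition `A` of the `n` indices; `k` has the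
`n + 1` components `k 0, …, k n`. -/
def partitionFunction {d : ℕ} (L : ℝ) (B : 𝓢(E d, ℝ)) (Pv : Measure ℝ) {n : ℕ}
    (A : Finpartition (Finset.univ : Finset (Fin n))) (k : Fin (n + 1) → dualLattice d L) : ℂ :=
  ∏ a ∈ A.parts,
    ((weightMoment Pv a.card : ℂ) *
      (deltaL L (∑ l ∈ a, ((k l.castSucc : E d) - (k l.succ : E d))) : ℂ) *
      ∏ l ∈ a, profileCoeff L B ((k l.castSucc : E d) - (k l.succ : E d)))

/-- The integrand of the momentum space formula. -/
def momentumIntegrand {d : ℕ} (L : ℝ) (B : 𝓢(E d, ℝ)) (Pv : Measure ℝ) (n : ℕ) (z : ℂ)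
    (ψ₁ ψ₂ : Lp ℂ 2 (volume : Measure (E d))) (k : Fin (n + 1) → dualLattice d L) : ℂ :=
  (∑ A : Finpartition (Finset.univ : Finset (Fin n)), partitionFunction L B Pv A k) *
    starRingEnd ℂ (fourierCoeff L (periodize L ψ₁) (k 0)) *
    fourierCoeff L (periodize L ψ₂) (k (Fin.last n)) *
    ∏ j : Fin (n + 1), ((nu (k j : E d) : ℂ) - z)⁻¹

/-- The reflection `𝔖_j` of the `j`-th coordinate. -/
def reflect {d : ℕ} (j : Fin d) (x : E d) : E d := WithLp.toLp 2 (Function.update x j (-x j))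

end PoissonSchrodinger

end

noncomputable section

namespace PoissonSchrodinger

/-! In the plane wave basis the free resolvent is diagonal with symbol `(ν - z)⁻¹`, and the
potential acts by convolution with `structureFactor ω · profileCoeff L B`, because each translate of
`B_#` contributes the same coefficient times a phase. Iterating writes the matrix element as a sum
over chains of momenta of a deterministic `chainTerm` times a product of structure factors
(`inner_freeResolvent_iterate`).

For fixed `M`, a product of `n` structure factors expands over maps from `{1,…,n}` to the
impurities. By independence the expectation factorizes over the fibers of the map: uniform positions
force the momentum transfers in each fiber to sum to zero, and weights give moments. A partition `A`
is the fiber partition of exactly `M.descFactorial |A|` maps, and the Poisson mean of that number is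
`|Λ_L|^|A|`, one volume for each delta (`integral_prod_structureFactor`).

The analytic point is to exchange expectation and sum. Structure factors are bounded by
`totalWeight`, whose powers are integrable, so absolute summability of `chainTerm` suffices
(`summable_norm_chainTerm`). The periodized profile may jump at the box boundary, so only the decay
`∏ (1 + |p_j|)⁻¹` is available, which is not summable; nor is the resolvent in high dimension.
Young's inequality bounds their product by summable weights uniformly in the other momentum
(`exists_norm_profileCoeff_mul_le`), so chains can be summed vertex by vertex. -/

/-! ### The box as a fundamental domain of the torus -/

/-- The product Haar probability measure on the torus `(ℝ / ℤ)^d`. -/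
abbrev torusMeasure (d : ℕ) : Measure (UnitAddTorus (Fin d)) :=
  Measure.pi fun _ => AddCircle.haarAddCircle

/-- The covering map `x ↦ x / L mod ℤ^d` onto the torus. -/
def toTorus {d : ℕ} (L : ℝ) (x : E d) : UnitAddTorus (Fin d) := fun j => ((x j / L : ℝ) : UnitAddCircle)

/-- The section of `toTorus` with values in the box `[-L/2, L/2)^d`. -/
def ofTorus {d : ℕ} (L : ℝ) (t : UnitAddTorus (Fin d)) : E d :=
  WithLp.toLp 2 fun j => L * (AddCircle.equivIco 1 (-(1 / 2)) (t j) : ℝ)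

lemma measurable_ofTorus {d : ℕ} (L : ℝ) : Measurable (ofTorus (d := d) L) := by
  unfold ofTorus
  refine (WithLp.measurable_toLp 2 _).comp (measurable_pi_lambda _ fun j => Measurable.const_mul ?_ _)
  exact measurable_subtype_coe.comp
    ((AddCircle.measurableEquivIco 1 (-(1 / 2))).measurable.comp (measurable_pi_apply j))

/-- Identifies periodized functions with pullbacks from the torus, so that translations become group
translations. -/
lemma ofTorus_toTorus {d : ℕ} {L : ℝ} (hL : 0 < L) (x : E d) :
    ofTorus L (toTorus L x) = wrap L x := by
  ext j
  change L * (AddCircle.equivIco 1 (-(1 / 2)) ((x j / L : ℝ) : UnitAddCircle) : ℝ) =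
    x j - L * (⌊x j / L + 1 / 2⌋ : ℝ)
  have hmem : x j / L - ⌊x j / L + 1 / 2⌋ ∈ Set.Ico (-(1 / 2) : ℝ) (-(1 / 2) + 1) := by
    have h1 := Int.floor_le (x j / L + 1 / 2)
    have h2 := Int.lt_floor_add_one (x j / L + 1 / 2)
    constructor <;> linarith
  have hcoe : ((x j / L : ℝ) : UnitAddCircle) =
      ((x j / L - ⌊x j / L + 1 / 2⌋ : ℝ) : UnitAddCircle) := by
    rw [AddCircle.coe_sub, (AddCircle.coe_eq_zero_iff (1 : ℝ) (x := (⌊x j / L + 1 / 2⌋ : ℝ))).2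
      ⟨⌊x j / L + 1 / 2⌋, by simp⟩, sub_zero]
  rw [hcoe, AddCircle.equivIco_coe_eq hmem]
  field_simp

lemma toTorus_sub {d : ℕ} (L : ℝ) (x y : E d) : toTorus L (x - y) = toTorus L x - toTorus L y := by
  ext j
  simp [toTorus, sub_div]

lemma measurePreserving_coe_torus (d : ℕ) :
    MeasurePreserving (fun x : Fin d → ℝ => (fun j => (x j : UnitAddCircle) : UnitAddTorus (Fin d)))
      (volume.restrict (Set.univ.pi fun _ => Set.Ico (-(1 / 2) : ℝ) (1 / 2))) (torusMeasure d) := by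
  have h1 : MeasurePreserving (fun t : ℝ => (t : UnitAddCircle))
      (volume.restrict (Set.Ico (-(1 / 2) : ℝ) (1 / 2))) AddCircle.haarAddCircle := by
    have h := AddCircle.measurePreserving_mk 1 (-(1 / 2))
    rw [AddCircle.volume_eq_smul_haarAddCircle, ENNReal.ofReal_one, one_smul,
      Measure.restrict_congr_set Ico_ae_eq_Ioc.symm] at h
    rwa [show -(1 / 2) + 1 = (1 / 2 : ℝ) by norm_num] at h
  have h := measurePreserving_pi (fun _ : Fin d => volume.restrict (Set.Ico (-(1 / 2) : ℝ) (1 / 2)))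
    (fun _ => AddCircle.haarAddCircle) fun _ => h1
  rwa [← Measure.restrict_pi_pi] at h

/-- The dilation `x ↦ x / L` carries Lebesgue measure to `L ^ d` times itself; the weight `(L ^
d)⁻¹` compensates for this. -/
lemma measurePreserving_toTorus (d : ℕ) {L : ℝ} (hL : 0 < L) :
    MeasurePreserving (toTorus (d := d) L) (ENNReal.ofReal ((L ^ d)⁻¹) • boxMeasure d L)
      (torusMeasure d) := by
  have h1 : MeasurePreserving (fun x : E d => L⁻¹ • x)
      (ENNReal.ofReal ((L ^ d)⁻¹) • (volume : Measure (E d))) volume := by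
    refine ⟨by fun_prop, ?_⟩
    rw [Measure.map_smul, Measure.map_addHaar_smul _ (inv_ne_zero hL.ne'), smul_smul,
      finrank_euclideanSpace_fin, ← ENNReal.ofReal_mul (by positivity), abs_of_pos (by positivity)]
    rw [show (L ^ d)⁻¹ * (L⁻¹ ^ d)⁻¹ = 1 by rw [inv_pow]; field_simp, ENNReal.ofReal_one, one_smul]
  have h2 := (PiLp.volume_preserving_ofLp (Fin d)).comp h1
  have hs : MeasurableSet (Set.univ.pi fun _ : Fin d => Set.Ico (-(1 / 2) : ℝ) (1 / 2)) :=
    MeasurableSet.univ_pi fun _ => measurableSet_Ico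
  have h3 := (measurePreserving_coe_torus d).comp (h2.restrict_preimage hs)
  have hpre : (WithLp.ofLp ∘ fun x : E d => L⁻¹ • x) ⁻¹'
      (Set.univ.pi fun _ : Fin d => Set.Ico (-(1 / 2) : ℝ) (1 / 2)) = box d L := by
    ext x
    simp only [Set.mem_preimage, Set.mem_pi, Set.mem_univ, true_imp_iff, Function.comp, Set.mem_Ico,
      box, Set.mem_ofPred_eq, PiLp.smul_apply, smul_eq_mul]
    refine forall_congr' fun j => ?_
    rw [inv_mul_lt_iff₀ hL, le_inv_mul_iff₀ hL]
    constructor <;> rintro ⟨a, b⟩ <;> constructor <;> linarith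
  rw [hpre, Measure.restrict_smul] at h3
  have hfun : toTorus (d := d) L = (fun (x : Fin d → ℝ) j => (x j : UnitAddCircle)) ∘
      WithLp.ofLp ∘ fun x : E d => L⁻¹ • x := by
    funext x j
    simp [toTorus, div_eq_inv_mul]
  rw [hfun]
  exact h3

lemma boxVol_eq (d : ℕ) {L : ℝ} (hL : 0 < L) : boxVol d L = L ^ d := by
  have h := (measurePreserving_toTorus d hL).measure_preimage (MeasurableSet.univ.nullMeasurableSet)
  rw [Set.preimage_univ, measure_univ (μ := torusMeasure d), Measure.smul_apply, Measure.restrict_apply_univ, smul_eq_mul] at h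
  have h2 := congrArg ENNReal.toReal h
  rw [ENNReal.toReal_mul, ENNReal.toReal_ofReal (by positivity), ENNReal.toReal_one] at h2
  change (L ^ d)⁻¹ * boxVol d L = 1 at h2
  field_simp at h2
  linarith

lemma boxVol_pos (d : ℕ) {L : ℝ} (hL : 0 < L) : 0 < boxVol d L := by
  rw [boxVol_eq d hL]; positivity

lemma setIntegral_box_comp_toTorus {d : ℕ} {L : ℝ} (hL : 0 < L) {g : UnitAddTorus (Fin d) → ℂ}
    (hg : AEStronglyMeasurable g (torusMeasure d)) :
    ∫ x in box d L, g (toTorus L x) = boxVol d L * ∫ t, g t ∂torusMeasure d := by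
  have hmp := measurePreserving_toTorus d hL
  have h := integral_map hmp.measurable.aemeasurable (f := g) (by rwa [hmp.map_eq])
  rw [hmp.map_eq, integral_smul_measure, ENNReal.toReal_ofReal (by positivity)] at h
  rw [h, boxVol_eq d hL, Complex.real_smul, ← mul_assoc]
  have : (L : ℂ) ≠ 0 := by exact_mod_cast hL.ne'
  push_cast
  field_simp

/-! ### The dual lattice and Fourier coefficients on the box -/

/-- The lattice point `m / L`. -/
def latticePoint {d : ℕ} (L : ℝ) (m : Fin d → ℤ) : E d := WithLp.toLp 2 fun j => (m j : ℝ) / L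

/-- The parametrization of the dual lattice by `ℤ^d`. -/
def latticeEquiv (d : ℕ) {L : ℝ} (hL : 0 < L) : (Fin d → ℤ) ≃ dualLattice d L :=
  Equiv.ofBijective (fun m => ⟨latticePoint L m, fun j => ⟨m j, rfl⟩⟩) <| by
    constructor
    · intro m m' h
      ext j
      have h2 : (m j : ℝ) / L = (m' j : ℝ) / L := congrArg (fun p : dualLattice d L => (p : E d) j) h
      have := (div_left_inj' hL.ne').1 h2
      exact_mod_cast this
    · intro k
      choose m hm using k.2
      refine ⟨m, Subtype.ext ?_⟩
      ext j
      exact (hm j).symm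

lemma countable_dualLattice (d : ℕ) {L : ℝ} (hL : 0 < L) : Countable (dualLattice d L) :=
  (latticeEquiv d hL).symm.injective.countable

lemma coe_latticeEquiv {d : ℕ} {L : ℝ} (hL : 0 < L) (m : Fin d → ℤ) :
    (latticeEquiv d hL m : E d) = latticePoint L m := rfl

lemma expo_eq_prod {d : ℕ} (p x : E d) :
    expo p x = ∏ j, Complex.exp (2 * Real.pi * Complex.I * (p j * x j : ℝ)) := by
  rw [expo, ← Complex.exp_sum, PiLp.inner_apply]
  congr 1
  push_cast
  rw [Finset.mul_sum]
  refine Finset.sum_congr rfl fun j _ => ?_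
  simp
  ring

lemma expo_latticePoint {d : ℕ} (L : ℝ) (m : Fin d → ℤ) (x : E d) :
    expo (latticePoint L m) x = UnitAddTorus.mFourier m (toTorus L x) := by
  rw [expo_eq_prod]
  simp only [UnitAddTorus.mFourier, ContinuousMap.coe_mk, toTorus, fourier_coe_apply, latticePoint]
  refine Finset.prod_congr rfl fun j _ => ?_
  congr 1
  push_cast
  ring

lemma exp_neg_eq_expo_neg {d : ℕ} (p x : E d) :
    Complex.exp (-(2 * Real.pi * Complex.I * (inner ℝ p x : ℝ))) = expo (-p) x := by
  simp [expo, inner_neg_left]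

lemma fourierCoeff_eq {d : ℕ} (L : ℝ) (f : E d → ℂ) (p : E d) :
    fourierCoeff L f p = ∫ x in box d L, expo (-p) x * f x := by
  simp only [fourierCoeff, exp_neg_eq_expo_neg]

lemma expo_add {d : ℕ} (p q x : E d) : expo (p + q) x = expo p x * expo q x := by
  simp [expo, inner_add_left, ← Complex.exp_add, mul_add]

lemma expo_add_right {d : ℕ} (p x y : E d) : expo p (x + y) = expo p x * expo p y := by
  simp [expo, inner_add_right, ← Complex.exp_add, mul_add]

lemma expo_zero {d : ℕ} (x : E d) : expo 0 x = 1 := by simp [expo]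

lemma conj_expo {d : ℕ} (p x : E d) : starRingEnd ℂ (expo p x) = expo (-p) x := by
  simp [expo, ← Complex.exp_conj, inner_neg_left, Complex.conj_ofNat]

lemma norm_expo {d : ℕ} (p x : E d) : ‖expo p x‖ = 1 := by
  simp [expo, Complex.norm_exp]

lemma continuous_expo {d : ℕ} (p : E d) : Continuous (expo p) := by
  unfold expo
  fun_prop

lemma neg_mem_dualLattice {d : ℕ} {L : ℝ} {p : E d} (hp : p ∈ dualLattice d L) :
    -p ∈ dualLattice d L := fun j => by
  obtain ⟨m, hm⟩ := hp j
  exact ⟨-m, by simp [hm, neg_div]⟩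

lemma add_mem_dualLattice {d : ℕ} {L : ℝ} {p q : E d} (hp : p ∈ dualLattice d L)
    (hq : q ∈ dualLattice d L) : p + q ∈ dualLattice d L := fun j => by
  obtain ⟨m, hm⟩ := hp j
  obtain ⟨m', hm'⟩ := hq j
  exact ⟨m + m', by simp [hm, hm', add_div]⟩

lemma sub_mem_dualLattice {d : ℕ} {L : ℝ} {p q : E d} (hp : p ∈ dualLattice d L)
    (hq : q ∈ dualLattice d L) : p - q ∈ dualLattice d L := by
  rw [sub_eq_add_neg]; exact add_mem_dualLattice hp (neg_mem_dualLattice hq)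

lemma exists_eq_latticePoint {d : ℕ} {L : ℝ} {p : E d} (hp : p ∈ dualLattice d L) :
    ∃ m, p = latticePoint L m := by
  choose m hm using hp
  exact ⟨m, by ext j; exact hm j⟩

/-- Fourier coefficients of a translate of a periodized function. -/
lemma fourierCoeff_periodize_translate {d : ℕ} {L : ℝ} (hL : 0 < L) {h : E d → ℂ}
    (hh : Measurable h) {p : E d} (hp : p ∈ dualLattice d L) (y : E d) :
    fourierCoeff L (fun x => periodize L h (x - y)) p =
      expo (-p) y * fourierCoeff L (periodize L h) p := by
  obtain ⟨m, hm⟩ := exists_eq_latticePoint (neg_mem_dualLattice hp)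
  -- By invariance of Haar measure the integral over the box does not depend on `y`; it is then
  -- compared with its value at `y = 0`.
  have hG : ∀ y : E d, ∫ x in box d L, expo (-p) (x - y) * periodize L h (x - y) =
      boxVol d L * ∫ t, (UnitAddTorus.mFourier m t * h (ofTorus L t)) ∂torusMeasure d := by
    intro y
    have hmeas : Measurable fun t => UnitAddTorus.mFourier m t * h (ofTorus L t) :=
      (UnitAddTorus.mFourier m).continuous.measurable.mul (hh.comp (measurable_ofTorus L))
    rw [← integral_sub_right_eq_self _ (toTorus L y), ← setIntegral_box_comp_toTorus hL]
    · simp only [← toTorus_sub, hm, expo_latticePoint, ofTorus_toTorus hL, periodize]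
    · exact (hmeas.comp (measurable_id.sub_const _)).aestronglyMeasurable
  have h1 := hG y
  have h0 := hG 0
  simp only [sub_zero] at h0
  rw [← h0] at h1
  rw [fourierCoeff_eq, fourierCoeff_eq, ← h1, ← integral_const_mul]
  refine integral_congr_ae (Filter.Eventually.of_forall fun x => ?_)
  simp only
  conv_lhs => rw [← sub_add_cancel x y, expo_add_right, sub_add_cancel]
  ring

open Classical in
lemma setIntegral_expo {d : ℕ} {L : ℝ} (hL : 0 < L) {p : E d} (hp : p ∈ dualLattice d L) :
    ∫ x in box d L, expo p x = if p = 0 then (boxVol d L : ℂ) else 0 := by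
  split_ifs with h
  · simp [h, expo_zero, boxVol, Measure.real]
  · obtain ⟨j, hj⟩ : ∃ j, p j ≠ 0 := by
      by_contra hc
      push Not at hc
      exact h (by ext j; exact hc j)
    -- translating by half a period in the `j`-th direction changes the sign
    have ht := fourierCoeff_periodize_translate hL (h := fun _ => 1) measurable_const
      (neg_mem_dualLattice hp) (WithLp.toLp 2 (Pi.single j (1 / (2 * p j))))
    simp only [fourierCoeff_eq, periodize, mul_one, neg_neg] at ht
    have he : expo p (WithLp.toLp 2 (Pi.single j (1 / (2 * p j)))) = -1 := by
      rw [expo_eq_prod, Finset.prod_eq_single j]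
      · simp only [Pi.single_eq_same]
        rw [show p j * (1 / (2 * p j)) = 1 / 2 by field_simp]
        rw [← Complex.exp_pi_mul_I]
        congr 1
        push_cast
        ring
      · intro b _ hb
        simp [Pi.single_eq_of_ne hb]
      · simp
    rw [he] at ht
    linear_combination ht / 2

/-! ### Plane waves as a Hilbert basis -/

/-- A square integrable function on the box with vanishing Fourier coefficients vanishes. -/
lemma eq_zero_of_fourierCoeff_eq_zero {d : ℕ} {L : ℝ} (hL : 0 < L) (f : L2Box d L)
    (hf : ∀ p ∈ dualLattice d L, fourierCoeff L f p = 0) : f = 0 := by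
  have hmp := measurePreserving_toTorus d hL
  have hc : ENNReal.ofReal ((L ^ d)⁻¹) ≠ 0 := by
    rw [Ne, ENNReal.ofReal_eq_zero, not_le]; positivity
  -- A genuinely measurable representative is needed to compose with the section `ofTorus`.
  let f' : E d → ℂ := (Lp.aestronglyMeasurable f).mk f
  have hf'm : StronglyMeasurable f' := (Lp.aestronglyMeasurable f).stronglyMeasurable_mk
  have hff' : f =ᵐ[boxMeasure d L] f' := (Lp.aestronglyMeasurable f).ae_eq_mk
  let g : UnitAddTorus (Fin d) → ℂ := fun t => f' (ofTorus L t)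
  have hgm : Measurable g := hf'm.measurable.comp (measurable_ofTorus L)
  have hgq : (fun x => g (toTorus L x)) =ᵐ[boxMeasure d L] f' := by
    filter_upwards [ae_restrict_mem (measurableSet_box d L)] with x hx
    simp only [g, ofTorus_toTorus hL, wrap_eq_self hx]
  have hg2 : MemLp g 2 (torusMeasure d) := by
    rw [← hmp.map_eq, memLp_map_measure_iff hgm.aestronglyMeasurable hmp.measurable.aemeasurable]
    refine MemLp.smul_measure ?_ ENNReal.ofReal_ne_top
    exact (memLp_congr_ae (hgq.trans hff'.symm)).2 (Lp.memLp f)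
  have hcoeff : ∀ m, ∫ t, UnitAddTorus.mFourier (-m) t * g t ∂torusMeasure d = 0 := by
    intro m
    have h1 := setIntegral_box_comp_toTorus hL
      (g := fun t => UnitAddTorus.mFourier (-m) t * g t)
      (((UnitAddTorus.mFourier (-m)).continuous.measurable.mul hgm).aestronglyMeasurable)
    have h2 := hf (-latticePoint L (-m)) (neg_mem_dualLattice fun j => ⟨_, rfl⟩)
    rw [fourierCoeff_eq] at h2
    have h3 : ∫ x in box d L, UnitAddTorus.mFourier (-m) (toTorus L x) * g (toTorus L x) = 0 := by
      rw [← h2]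
      refine integral_congr_ae ?_
      filter_upwards [hgq, hff'] with x hx hx'
      rw [hx, hx', neg_neg, expo_latticePoint]
    rw [h3] at h1
    have := boxVol_pos d hL
    simpa [this.ne'] using h1.symm
  -- Completeness of the characters on the torus is what makes vanishing coefficients decisive.
  have hg0 : hg2.toLp g = 0 := by
    have hrepr : UnitAddTorus.mFourierBasis.repr (hg2.toLp g) = 0 := by
      ext m
      rw [UnitAddTorus.mFourierBasis_repr, UnitAddTorus.mFourierCoeff, lp.coeFn_zero, Pi.zero_apply,
        ← hcoeff m]
      refine integral_congr_ae ?_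
      filter_upwards [hg2.coeFn_toLp] with t ht
      rw [ht, smul_eq_mul]
    exact (LinearIsometryEquiv.map_eq_zero_iff _).1 hrepr
  have hgz : g =ᵐ[torusMeasure d] 0 := by
    filter_upwards [hg2.coeFn_toLp, Lp.coeFn_zero ℂ 2 (torusMeasure d)] with t h1 h2
    rw [← h1, hg0, h2]
  have hz := hmp.quasiMeasurePreserving.ae_eq_comp hgz
  rw [Filter.EventuallyEq, Measure.ae_ennreal_smul_measure_iff hc] at hz
  rw [Lp.eq_zero_iff_ae_eq_zero]
  filter_upwards [hz, hgq, hff'] with x h1 h2 h3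
  rw [h3, ← h2]
  exact h1

/-- The plane wave `expo p` as an element of `L²(Λ_L)`. -/
def expoL2 {d : ℕ} (L : ℝ) (p : E d) : L2Box d L := (memLp_expo L p).toLp (expo p)

lemma coeFn_expoL2 {d : ℕ} (L : ℝ) (p : E d) : expoL2 L p =ᵐ[boxMeasure d L] expo p :=
  (memLp_expo L p).coeFn_toLp

lemma fourierCoeff_congr {d : ℕ} {L : ℝ} {f g : E d → ℂ} (h : f =ᵐ[boxMeasure d L] g) (p : E d) :
    fourierCoeff L f p = fourierCoeff L g p := by
  unfold fourierCoeff
  refine integral_congr_ae ?_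
  filter_upwards [h] with x hx
  rw [hx]

/-- Lets linearity of the coefficients on `L²(Λ_L)` be inherited from the inner product. -/
lemma inner_expoL2 {d : ℕ} {L : ℝ} (p : E d) (f : L2Box d L) :
    inner ℂ (expoL2 L p) f = fourierCoeff L f p := by
  rw [L2.inner_def, fourierCoeff_eq]
  refine integral_congr_ae ?_
  filter_upwards [coeFn_expoL2 L p] with x hx
  rw [hx, RCLike.inner_apply, conj_expo, mul_comm]

open Classical in
lemma inner_expoL2_expoL2 {d : ℕ} {L : ℝ} (hL : 0 < L) (p q : dualLattice d L) :
    inner ℂ (expoL2 L (p : E d)) (expoL2 L (q : E d)) = if p = q then (boxVol d L : ℂ) else 0 := by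
  rw [inner_expoL2, fourierCoeff_congr (coeFn_expoL2 L _), fourierCoeff_eq]
  simp only [← expo_add]
  rw [setIntegral_expo hL (add_mem_dualLattice (neg_mem_dualLattice p.2) q.2)]
  refine if_congr ?_ rfl rfl
  rw [neg_add_eq_zero, Subtype.ext_iff]

/-- The normalizing factor `|Λ_L|^{-1/2}` of the plane waves. -/
def planeWaveNorm (d : ℕ) (L : ℝ) : ℂ := ((√(boxVol d L))⁻¹ : ℝ)

lemma planeWaveNorm_mul_self (d : ℕ) (L : ℝ) :
    planeWaveNorm d L * planeWaveNorm d L = (boxVol d L : ℂ)⁻¹ := by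
  rw [planeWaveNorm, ← Complex.ofReal_mul, ← mul_inv, Real.mul_self_sqrt (by exact measureReal_nonneg),
    Complex.ofReal_inv]

lemma planeWaveNorm_ne_zero (d : ℕ) {L : ℝ} (hL : 0 < L) : planeWaveNorm d L ≠ 0 := by
  intro h
  have h2 := planeWaveNorm_mul_self d L
  rw [h, mul_zero, eq_comm, inv_eq_zero, Complex.ofReal_eq_zero] at h2
  exact (boxVol_pos d hL).ne' h2

lemma conj_planeWaveNorm (d : ℕ) (L : ℝ) :
    starRingEnd ℂ (planeWaveNorm d L) = planeWaveNorm d L := Complex.conj_ofReal _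

lemma orthonormal_planeWave (d : ℕ) {L : ℝ} (hL : 0 < L) :
    Orthonormal ℂ fun p : dualLattice d L => planeWaveNorm d L • expoL2 L (p : E d) := by
  classical
  rw [orthonormal_iff_ite]
  intro p q
  rw [inner_smul_left, inner_smul_right, inner_expoL2_expoL2 hL, conj_planeWaveNorm]
  split_ifs with h
  · rw [← mul_assoc, planeWaveNorm_mul_self, inv_mul_cancel₀]
    exact_mod_cast (boxVol_pos d hL).ne'
  · simp

/-- The Hilbert basis of normalized plane waves. -/
def planeWaveBasis (d : ℕ) {L : ℝ} (hL : 0 < L) :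
    HilbertBasis (dualLattice d L) ℂ (L2Box d L) :=
  HilbertBasis.mkOfOrthogonalEqBot (orthonormal_planeWave d hL) <| by
    rw [Submodule.eq_bot_iff]
    intro f hf
    refine eq_zero_of_fourierCoeff_eq_zero hL f fun p hp => ?_
    have h := (Submodule.mem_orthogonal _ _).1 hf _ (Submodule.subset_span ⟨⟨p, hp⟩, rfl⟩)
    rw [inner_smul_left, inner_expoL2, conj_planeWaveNorm] at h
    exact (mul_eq_zero.1 h).resolve_left (planeWaveNorm_ne_zero d hL)

lemma planeWaveBasis_apply {d : ℕ} {L : ℝ} (hL : 0 < L) (p : dualLattice d L) :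
    planeWaveBasis d hL p = planeWaveNorm d L • expoL2 L (p : E d) := by
  simp [planeWaveBasis]

lemma planeWaveBasis_repr {d : ℕ} {L : ℝ} (hL : 0 < L) (f : L2Box d L) (p : dualLattice d L) :
    (planeWaveBasis d hL).repr f p = planeWaveNorm d L * fourierCoeff L f p := by
  rw [HilbertBasis.repr_apply_apply, planeWaveBasis_apply, inner_smul_left, inner_expoL2,
    conj_planeWaveNorm]

/-- Parseval's identity. -/
lemma hasSum_fourierCoeff {d : ℕ} {L : ℝ} (hL : 0 < L) (f g : L2Box d L) :
    HasSum (fun p : dualLattice d L =>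
        (boxVol d L : ℂ)⁻¹ * (starRingEnd ℂ (fourierCoeff L f p) * fourierCoeff L g p))
      (inner ℂ f g) := by
  refine HasSum.congr_fun ((planeWaveBasis d hL).hasSum_inner_mul_inner f g) fun p => ?_
  rw [← inner_conj_symm, ← HilbertBasis.repr_apply_apply, ← HilbertBasis.repr_apply_apply,
    planeWaveBasis_repr, planeWaveBasis_repr, map_mul, conj_planeWaveNorm, ← planeWaveNorm_mul_self]
  ring

lemma memℓp_fourierCoeff {d : ℕ} {L : ℝ} (hL : 0 < L) (f : L2Box d L) :
    Memℓp (fun p : dualLattice d L => fourierCoeff L f p) 2 := by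
  have h := (lp.memℓp ((planeWaveBasis d hL).repr f)).const_smul (planeWaveNorm d L)⁻¹
  have he : (fun p : dualLattice d L => fourierCoeff L f p) =
      (planeWaveNorm d L)⁻¹ • ⇑((planeWaveBasis d hL).repr f) := by
    ext p
    rw [Pi.smul_apply, planeWaveBasis_repr, smul_eq_mul,
      inv_mul_cancel_left₀ (planeWaveNorm_ne_zero d hL)]
  rw [he]
  exact h

/-- Square summability makes the defining series converge: it is the orthonormal expansion with
coordinates `planeWaveNorm d L * g q`. -/
lemma fourierCoeff_invFourier {d : ℕ} {L : ℝ} (hL : 0 < L) {g : dualLattice d L → ℂ}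
    (hg : Memℓp g 2) (p : dualLattice d L) : fourierCoeff L (invFourier L g) p = g p := by
  let w : lp (fun _ : dualLattice d L => ℂ) 2 := ⟨_, hg.const_smul (planeWaveNorm d L)⟩
  have hw : ∀ q, w q = planeWaveNorm d L * g q := fun q => rfl
  have hs := (planeWaveBasis d hL).hasSum_repr_symm w
  have hF : invFourier L g = (planeWaveBasis d hL).repr.symm w := by
    rw [← hs.tsum_eq, invFourier, ← tsum_const_smul'']
    refine tsum_congr fun q => ?_
    rw [planeWaveBasis_apply, hw, smul_smul, smul_smul, ← planeWaveNorm_mul_self]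
    congr 1
    ring
  have h := planeWaveBasis_repr hL (invFourier L g) p
  rw [hF, LinearIsometryEquiv.apply_symm_apply, hw, ← hF] at h
  exact (mul_left_cancel₀ (planeWaveNorm_ne_zero d hL) h).symm

lemma fourierCoeff_sub_smul {d : ℕ} {L : ℝ} (f g : L2Box d L) (c : ℂ) (p : E d) :
    fourierCoeff L (f - c • g : L2Box d L) p = fourierCoeff L f p - c * fourierCoeff L g p := by
  rw [← inner_expoL2, ← inner_expoL2, ← inner_expoL2, inner_sub_right, inner_smul_right]

lemma fourierCoeff_smul {d : ℕ} {L : ℝ} (f : L2Box d L) (c : ℂ) (p : E d) :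
    fourierCoeff L (c • f : L2Box d L) p = c * fourierCoeff L f p := by
  rw [← inner_expoL2, ← inner_expoL2, inner_smul_right]

lemma eq_of_fourierCoeff_eq {d : ℕ} {L : ℝ} (hL : 0 < L) {f g : L2Box d L}
    (h : ∀ p : dualLattice d L, fourierCoeff L f p = fourierCoeff L g p) : f = g := by
  rw [← sub_eq_zero]
  refine eq_zero_of_fourierCoeff_eq_zero hL _ fun p hp => ?_
  have := fourierCoeff_sub_smul f g 1 p
  rw [one_smul] at this
  rw [this, h ⟨p, hp⟩, one_mul, sub_self]

/-! ### The free resolvent as a Fourier multiplier -/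

lemma nu_nonneg {d : ℕ} (p : E d) : 0 ≤ nu p := by unfold nu; positivity

/-- The distance of the spectral parameter to `t ∈ [0, ∞)` is at least of order `1 + t`. -/
lemma exists_one_add_le_mul_norm_sub {z : ℂ} (hz : ∀ t : ℝ, 0 ≤ t → z ≠ (t : ℂ)) :
    ∃ C : ℝ, 0 < C ∧ ∀ t : ℝ, 0 ≤ t → 1 + t ≤ C * ‖(t : ℂ) - z‖ := by
  obtain ⟨δ, hδ, hδz⟩ : ∃ δ : ℝ, 0 < δ ∧ ∀ t : ℝ, 0 ≤ t → δ ≤ ‖(t : ℂ) - z‖ := by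
    by_cases him : z.im = 0
    · have hre : z.re < 0 := by
        by_contra hc
        exact hz z.re (not_lt.1 hc) (Complex.ext (by simp) (by simp [him]))
      refine ⟨-z.re, by linarith, fun t ht => ?_⟩
      refine le_trans ?_ (Complex.abs_re_le_norm _)
      simp only [Complex.sub_re, Complex.ofReal_re]
      exact le_trans (by linarith) (le_abs_self _)
    · refine ⟨|z.im|, abs_pos.2 him, fun t _ => ?_⟩
      refine le_trans ?_ (Complex.abs_im_le_norm _)
      simp
  -- The constant comes from `1 + t ≤ (1 + ‖z‖) + ‖t - z‖`, where the first summand is absorbed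
  -- using `δ ≤ ‖t - z‖`.
  refine ⟨(1 + ‖z‖) / δ + 1, by positivity, fun t ht => ?_⟩
  have h1 := hδz t ht
  have h2 : t ≤ ‖(t : ℂ) - z‖ + ‖z‖ := by
    have := norm_add_le ((t : ℂ) - z) z
    rwa [sub_add_cancel, Complex.norm_real, Real.norm_of_nonneg ht] at this
  have h3 : 1 + ‖z‖ ≤ (1 + ‖z‖) / δ * ‖(t : ℂ) - z‖ := by
    rw [div_mul_eq_mul_div, le_div_iff₀ hδ]
    exact mul_le_mul_of_nonneg_left h1 (by positivity)
  linarith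

lemma nu_sub_ne_zero {d : ℕ} {z : ℂ} (hz : ∀ t : ℝ, 0 ≤ t → z ≠ (t : ℂ)) (p : E d) :
    (nu p : ℂ) - z ≠ 0 := fun h => hz _ (nu_nonneg p) (sub_eq_zero.1 h).symm

lemma norm_inv_nu_sub_le {d : ℕ} {z : ℂ} {C : ℝ} (hC : 0 < C)
    (h : ∀ t : ℝ, 0 ≤ t → 1 + t ≤ C * ‖(t : ℂ) - z‖) (p : E d) :
    ‖((nu p : ℂ) - z)⁻¹‖ ≤ C / (1 + nu p) := by
  have h1 := h _ (nu_nonneg p)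
  have h0 := nu_nonneg p
  have hpos : 0 < ‖(nu p : ℂ) - z‖ := by
    by_contra hc
    nlinarith
  rw [norm_inv, inv_eq_one_div, div_le_div_iff₀ hpos (by linarith)]
  linarith

lemma memℓp_of_norm_le {ι : Type*} {f g : ι → ℂ} {C : ℝ} (hg : Memℓp g 2)
    (h : ∀ i, ‖f i‖ ≤ C * ‖g i‖) : Memℓp f 2 := by
  refine memℓp_gen ?_
  have hs := ((memℓp_gen_iff (by norm_num)).1 hg).mul_left (C ^ 2)
  refine Summable.of_nonneg_of_le (fun i => by positivity) (fun i => ?_) hs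
  simp only [ENNReal.toReal_ofNat, Real.rpow_two]
  rw [← mul_pow]
  exact pow_le_pow_left₀ (norm_nonneg _) (h i) 2

/-- The free Hamiltonian shifted by `-z` in Fourier space. -/
lemma fourierCoeff_freeHamiltonian_sub {d : ℕ} {L : ℝ} (hL : 0 < L) (z : ℂ)
    (g : laplacianDomain d L) (p : dualLattice d L) :
    fourierCoeff L (freeHamiltonian g - z • (g : L2Box d L) : L2Box d L) p =
      ((nu (p : E d) : ℂ) - z) * fourierCoeff L (g : L2Box d L) p := by
  have hmem : Memℓp (fun p : dualLattice d L =>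
      ((2 * (2 * Real.pi) ^ 2 * nu (p : E d) : ℝ) : ℂ) * fourierCoeff L (g : L2Box d L) p) 2 := by
    have h := Memℓp.const_smul g.2 (2 * (2 * Real.pi) ^ 2 : ℂ)
    convert h using 1
    ext p
    simp only [Pi.smul_apply, smul_eq_mul]
    push_cast
    ring
  rw [fourierCoeff_sub_smul, freeHamiltonian, fourierCoeff_smul, negLaplacian,
    fourierCoeff_invFourier hL hmem]
  have hpi : (Real.pi : ℂ) ≠ 0 := by exact_mod_cast Real.pi_ne_zero
  push_cast
  field_simp

/-- The free resolvent in Fourier space. -/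
lemma fourierCoeff_freeResolvent {d : ℕ} {L : ℝ} (hL : 0 < L) {z : ℂ}
    (hz : ∀ t : ℝ, 0 ≤ t → z ≠ (t : ℂ)) (f : L2Box d L) (p : dualLattice d L) :
    fourierCoeff L (freeResolvent z f) p = ((nu (p : E d) : ℂ) - z)⁻¹ * fourierCoeff L f p := by
  obtain ⟨C, hC, hCz⟩ := exists_one_add_le_mul_norm_sub hz
  have hbd : ∀ p : dualLattice d L, ‖((nu (p : E d) : ℂ) - z)⁻¹‖ ≤ C ∧
      ‖(nu (p : E d) : ℂ) * ((nu (p : E d) : ℂ) - z)⁻¹‖ ≤ C := by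
    intro p
    have h1 := norm_inv_nu_sub_le hC hCz (p : E d)
    have h0 := nu_nonneg (p : E d)
    constructor
    · exact h1.trans (div_le_self hC.le (by linarith))
    · rw [norm_mul, Complex.norm_real, Real.norm_of_nonneg h0]
      calc _ ≤ nu (p : E d) * (C / (1 + nu (p : E d))) := mul_le_mul_of_nonneg_left h1 h0
        _ ≤ C := by
          rw [← mul_div_assoc, div_le_iff₀ (by linarith)]
          nlinarith
  have hmem1 : Memℓp (fun p : dualLattice d L =>
      ((nu (p : E d) : ℂ) - z)⁻¹ * fourierCoeff L f p) 2 :=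
    memℓp_of_norm_le (memℓp_fourierCoeff hL f) fun p => by
      rw [norm_mul]
      exact mul_le_mul_of_nonneg_right (hbd p).1 (norm_nonneg _)
  -- The candidate preimage lies in the domain because `ν / (ν - z)` is bounded.
  have hdom : invFourier L (fun p : dualLattice d L =>
      ((nu (p : E d) : ℂ) - z)⁻¹ * fourierCoeff L f p) ∈ laplacianDomain d L := by
    refine memℓp_of_norm_le (C := C) (memℓp_fourierCoeff hL f) fun p => ?_
    rw [fourierCoeff_invFourier hL hmem1, ← mul_assoc, norm_mul]
    exact mul_le_mul_of_nonneg_right (hbd p).2 (norm_nonneg _)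
  have hsurj : ∃ g : laplacianDomain d L, freeHamiltonian g - z • (g : L2Box d L) = f := by
    refine ⟨⟨_, hdom⟩, eq_of_fourierCoeff_eq hL fun p => ?_⟩
    rw [fourierCoeff_freeHamiltonian_sub hL, fourierCoeff_invFourier hL hmem1,
      mul_inv_cancel_left₀ (nu_sub_ne_zero hz _)]
  -- Whichever preimage `Function.invFun` selects, its coefficients are determined by division by `ν
  -- - z`, so existence of a preimage is enough.
  have h := fourierCoeff_freeHamiltonian_sub hL z (Function.invFun
    (fun g : laplacianDomain d L => freeHamiltonian g - z • (g : L2Box d L)) f) p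
  have he := Function.invFun_eq hsurj
  rw [he] at h
  rw [h, freeResolvent, inv_mul_cancel_left₀ (nu_sub_ne_zero hz _)]

/-! ### The random potential in Fourier space -/

/-- The structure function `∑_{γ < M} v_γ exp (-2 π i p · y_γ)` of a configuration. -/
def structureFactor {d : ℕ} (ω : Config d) (p : E d) : ℂ :=
  ∑ γ ∈ Finset.range ω.1, (ω.2.2 γ : ℂ) * expo (-p) (ω.2.1 γ)

lemma measurable_profile {d : ℕ} (B : 𝓢(E d, ℝ)) : Measurable fun x => (B x : ℂ) :=
  (Complex.continuous_ofReal.comp B.continuous).measurable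

/-- The Fourier coefficients of the random potential. -/
lemma fourierCoeff_potential {d : ℕ} {L : ℝ} (hL : 0 < L) (B : 𝓢(E d, ℝ)) (ω : Config d)
    {p : E d} (hp : p ∈ dualLattice d L) :
    fourierCoeff L (fun x => (potential L B ω x : ℂ)) p =
      structureFactor ω p * profileCoeff L B p := by
  obtain ⟨C, hC⟩ := B.decay 0 0
  have hint : ∀ y : E d, Integrable
      (fun x => expo (-p) x * periodize L (fun x => (B x : ℂ)) (x - y)) (boxMeasure d L) := by
    intro y
    refine Integrable.of_bound (C := C) ?_ (Filter.Eventually.of_forall fun x => ?_)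
    · refine ((continuous_expo _).measurable.mul ?_).aestronglyMeasurable
      exact (measurable_profile B).comp ((measurable_wrap L).comp (measurable_id.sub_const _))
    · rw [norm_mul, norm_expo, one_mul]
      simpa [periodize] using hC.2 (wrap L (x - y))
  have hterm : ∀ y : E d, ∫ x in box d L, expo (-p) x * periodize L (fun x => (B x : ℂ)) (x - y) =
      expo (-p) y * profileCoeff L B p := by
    intro y
    rw [profileCoeff, ← fourierCoeff_periodize_translate hL (measurable_profile B) hp,
      fourierCoeff_eq]
  rw [fourierCoeff_eq, structureFactor, Finset.sum_mul]
  have hsum : ∀ x, expo (-p) x * (potential L B ω x : ℂ) = ∑ γ ∈ Finset.range ω.1,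
      (ω.2.2 γ : ℂ) * (expo (-p) x * periodize L (fun x => (B x : ℂ)) (x - ω.2.1 γ)) := by
    intro x
    simp only [potential, periodize]
    push_cast
    rw [Finset.mul_sum]
    exact Finset.sum_congr rfl fun γ _ => by ring
  simp only [hsum]
  rw [integral_finsetSum _ fun γ _ => (hint _).const_mul _]
  refine Finset.sum_congr rfl fun γ _ => ?_
  rw [integral_const_mul, hterm, mul_assoc]

/-- Multiplication by the random potential is convolution in Fourier space. -/
lemma hasSum_fourierCoeff_potentialOp {d : ℕ} {L : ℝ} (hL : 0 < L) (B : 𝓢(E d, ℝ)) (ω : Config d)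
    (f : L2Box d L) (p : dualLattice d L) :
    HasSum (fun q : dualLattice d L => (boxVol d L : ℂ)⁻¹ *
        (structureFactor ω ((p : E d) - q) * profileCoeff L B ((p : E d) - q) *
          fourierCoeff L f q))
      (fourierCoeff L (potentialOp B ω f) p) := by
  -- The potential is real, so it may be moved onto the plane wave. Parseval then applies to `V e_p`
  -- and `f`, and the conjugate coefficient of `V e_p` at `q` is the coefficient of `V` at `p - q`.
  have hadj : fourierCoeff L (potentialOp B ω f) p =
      inner ℂ (potentialOp B ω (expoL2 L (p : E d))) f := by
    rw [fourierCoeff_eq, L2.inner_def]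
    refine integral_congr_ae ?_
    filter_upwards [(memLp_potential_mul B ω f).coeFn_toLp,
      (memLp_potential_mul B ω (expoL2 L (p : E d))).coeFn_toLp, coeFn_expoL2 L (p : E d)]
      with x h1 h2 h3
    simp only [potentialOp]
    rw [h1, h2, h3, RCLike.inner_apply, map_mul, Complex.conj_ofReal, conj_expo]
    ring
  rw [hadj]
  convert hasSum_fourierCoeff hL (potentialOp B ω (expoL2 L (p : E d))) f using 1
  ext q
  congr 2
  rw [← fourierCoeff_potential hL B ω (sub_mem_dualLattice p.2 q.2), fourierCoeff_eq,
    fourierCoeff_eq, ← integral_conj]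
  refine integral_congr_ae ?_
  filter_upwards [(memLp_potential_mul B ω (expoL2 L (p : E d))).coeFn_toLp,
    coeFn_expoL2 L (p : E d)] with x h1 h2
  simp only [potentialOp]
  rw [h1, h2, map_mul, map_mul, conj_expo, conj_expo, Complex.conj_ofReal, neg_neg, neg_sub,
    sub_eq_add_neg, expo_add]
  ring

/-! ### Decay of the profile coefficients -/

open scoped FourierTransform in
/-- A Schwartz function is a superposition of plane waves with a Schwartz amplitude. -/
lemma exists_schwartz_amplitude {d : ℕ} (B : 𝓢(E d, ℝ)) :
    ∃ A : 𝓢(E d, ℂ), ∀ x, (B x : ℂ) = ∫ ξ, expo ξ x * A ξ := by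
  let f : 𝓢(E d, ℂ) := B.postcompCLM Complex.ofRealCLM
  refine ⟨𝓕 f, fun x => ?_⟩
  have h : 𝓕⁻ (𝓕 f) = f := FourierTransform.fourierInv_fourier_eq f
  have h2 : 𝓕⁻ (𝓕 f) x = f x := by rw [h]
  rw [SchwartzMap.fourierInv_coe, Real.fourierInv_eq'] at h2
  have h3 : f x = (B x : ℂ) := rfl
  rw [← h3, ← h2]
  refine integral_congr_ae (Filter.Eventually.of_forall fun ξ => ?_)
  simp only [expo, smul_eq_mul]
  congr 2
  push_cast
  ring

lemma setIntegral_expo_eq_prod {d : ℕ} (L : ℝ) (q : E d) :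
    ∫ x in box d L, expo q x = ∏ j, ∫ t in Set.Ico (-(L / 2)) (L / 2),
      Complex.exp (2 * Real.pi * Complex.I * (q j * t : ℝ)) := by
  have hs : box d L = WithLp.ofLp ⁻¹'
      (Set.univ.pi fun _ : Fin d => Set.Ico (-(L / 2)) (L / 2)) := by
    ext x
    simp [box]
  have h := (PiLp.volume_preserving_ofLp (Fin d)).setIntegral_preimage_emb
    (MeasurableEquiv.toLp 2 (Fin d → ℝ)).symm.measurableEmbedding
    (fun x => ∏ j, Complex.exp (2 * Real.pi * Complex.I * (q j * x j : ℝ)))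
    (Set.univ.pi fun _ : Fin d => Set.Ico (-(L / 2)) (L / 2))
  rw [← hs] at h
  simp only [expo_eq_prod]
  rw [h, volume_pi, Measure.restrict_pi_pi]
  exact integral_fintype_prod_eq_prod
    (fun j (t : ℝ) => Complex.exp (2 * Real.pi * Complex.I * (q j * t : ℝ)))

/-- Adds two bounds on the integral `D`: the trivial `‖D‖ ≤ L`, and `‖D‖ |s| ≤ 1` from the explicit
antiderivative. -/
lemma norm_setIntegral_exp_mul_le {L : ℝ} (hL : 0 < L) (s : ℝ) :
    ‖∫ t in Set.Ico (-(L / 2)) (L / 2), Complex.exp (2 * Real.pi * Complex.I * (s * t : ℝ))‖ ≤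
      (L + 1) / (1 + |s|) := by
  have hn : ∀ t : ℝ, ‖Complex.exp (2 * Real.pi * Complex.I * (s * t : ℝ))‖ = 1 := fun t => by
    simp [Complex.norm_exp]
  set D := ∫ t in Set.Ico (-(L / 2)) (L / 2), Complex.exp (2 * Real.pi * Complex.I * (s * t : ℝ))
    with hD
  have h1 : ‖D‖ ≤ L := by
    have h := norm_setIntegral_le_of_norm_le_const (μ := volume)
      (s := Set.Ico (-(L / 2)) (L / 2)) (C := 1)
      (f := fun t : ℝ => Complex.exp (2 * Real.pi * Complex.I * (s * t : ℝ)))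
      (by simp) (fun t _ => (hn t).le)
    refine h.trans (le_of_eq ?_)
    rw [Real.volume_real_Ico_of_le (by linarith)]
    ring
  have h2 : ‖D‖ * |s| ≤ 1 := by
    by_cases hs : s = 0
    · simp [hs]
    have hpi : (Real.pi : ℂ) ≠ 0 := by exact_mod_cast Real.pi_ne_zero
    have hc : (2 * Real.pi * Complex.I * s : ℂ) ≠ 0 := by
      simp [hpi, hs]
    have he : D = (Complex.exp (2 * Real.pi * Complex.I * (s * (L / 2) : ℝ)) -
        Complex.exp (2 * Real.pi * Complex.I * (s * (-(L / 2)) : ℝ))) /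
          (2 * Real.pi * Complex.I * s) := by
      rw [hD, integral_Ico_eq_integral_Ioc,
        ← intervalIntegral.integral_of_le (by linarith)]
      have h := integral_exp_mul_complex (a := -(L / 2)) (b := L / 2) hc
      have hcast : ∀ t : ℝ, (2 * Real.pi * Complex.I * (s * t : ℝ) : ℂ) =
          2 * Real.pi * Complex.I * s * t := fun t => by push_cast; ring
      simp only [hcast]
      exact h
    have hnum := norm_sub_le (Complex.exp (2 * Real.pi * Complex.I * (s * (L / 2) : ℝ)))
      (Complex.exp (2 * Real.pi * Complex.I * (s * (-(L / 2)) : ℝ)))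
    rw [hn, hn] at hnum
    have hs' : 0 < |s| := abs_pos.2 hs
    have hden : ‖(2 * Real.pi * Complex.I * s : ℂ)‖ = 2 * Real.pi * |s| := by
      simp [abs_of_pos Real.pi_pos]
    rw [he, norm_div, hden, div_mul_eq_mul_div, div_le_iff₀ (by positivity)]
    have := Real.pi_gt_three
    nlinarith
  have hs0 := abs_nonneg s
  rw [le_div_iff₀ (by linarith)]
  linarith

/-- The product decay of the Fourier coefficients of the periodized profile. -/
lemma exists_norm_profileCoeff_le {d : ℕ} {L : ℝ} (hL : 0 < L) (B : 𝓢(E d, ℝ)) :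
    ∃ C : ℝ, 0 < C ∧ ∀ p : E d, ‖profileCoeff L B p‖ ≤ C * ∏ j, (1 + |p j|)⁻¹ := by
  obtain ⟨A, hA⟩ := exists_schwartz_amplitude B
  -- The weight pays for the `d` factors `1 + ‖ξ‖` lost below, one in each coordinate.
  have hAint : Integrable (fun ξ : E d => (1 + ‖ξ‖) ^ d * ‖A ξ‖) := by
    have h0 := (SchwartzMap.integrable_pow_mul volume A 0).const_mul (2 ^ d)
    have h1 := (SchwartzMap.integrable_pow_mul volume A d).const_mul (2 ^ d)
    refine Integrable.mono' (h0.add h1) ?_ (Filter.Eventually.of_forall fun ξ => ?_)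
    · exact Continuous.aestronglyMeasurable (by fun_prop)
    · rw [Real.norm_of_nonneg (by positivity)]
      have hp : (1 + ‖ξ‖) ^ d ≤ 2 ^ d * (1 + ‖ξ‖ ^ d) := by
        have h := norm_nonneg ξ
        rcases le_total ‖ξ‖ 1 with h' | h'
        · calc (1 + ‖ξ‖) ^ d ≤ 2 ^ d := pow_le_pow_left₀ (by positivity) (by linarith) _
            _ ≤ _ := le_mul_of_one_le_right (by positivity) (by linarith [pow_nonneg h d])
        · calc (1 + ‖ξ‖) ^ d ≤ (2 * ‖ξ‖) ^ d := pow_le_pow_left₀ (by positivity) (by linarith) _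
            _ = 2 ^ d * ‖ξ‖ ^ d := mul_pow _ _ _
            _ ≤ _ := mul_le_mul_of_nonneg_left (by linarith) (by positivity)
      simp only [Pi.add_apply, pow_zero, one_mul]
      calc _ ≤ 2 ^ d * (1 + ‖ξ‖ ^ d) * ‖A ξ‖ := mul_le_mul_of_nonneg_right hp (norm_nonneg _)
        _ = _ := by ring
  -- The summand `1` only serves to make the constant strictly positive.
  refine ⟨(L + 1) ^ d * (∫ ξ : E d, (1 + ‖ξ‖) ^ d * ‖A ξ‖) + 1, ?_, fun p => ?_⟩
  · have : 0 ≤ ∫ ξ : E d, (1 + ‖ξ‖) ^ d * ‖A ξ‖ := integral_nonneg fun ξ => by positivity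
    positivity
  have h1 : profileCoeff L B p = ∫ x in box d L, ∫ ξ, expo (-p) x * (expo ξ x * A ξ) := by
    rw [profileCoeff, fourierCoeff_eq]
    -- Inside the box `B_#` agrees with `B`, so the superposition of plane waves may be inserted;
    -- integrating each wave over the box then gives a product of one-dimensional integrals.
    refine setIntegral_congr_fun (measurableSet_box d L) fun x hx => ?_
    simp only [periodize]
    rw [wrap_eq_self hx, integral_const_mul, ← hA]
  have hint : Integrable (Function.uncurry fun (x ξ : E d) => expo (-p) x * (expo ξ x * A ξ))
      ((boxMeasure d L).prod volume) := by
    have hb : Integrable (fun x : E d × E d => (1 : ℂ) * A x.2) ((boxMeasure d L).prod volume) :=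
      (integrable_const (1 : ℂ)).mul_prod A.integrable
    refine hb.mono (Continuous.aestronglyMeasurable ?_) (Filter.Eventually.of_forall fun x => ?_)
    · unfold expo
      fun_prop
    · simp [Function.uncurry, norm_expo]
  rw [integral_integral_swap hint] at h1
  have h2 : profileCoeff L B p = ∫ ξ, (∫ x in box d L, expo (ξ - p) x) * A ξ := by
    rw [h1]
    refine integral_congr_ae (Filter.Eventually.of_forall fun ξ => ?_)
    simp only
    rw [← integral_mul_const]
    refine integral_congr_ae (Filter.Eventually.of_forall fun x => ?_)
    simp only
    rw [sub_eq_add_neg, expo_add]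
    ring
  have hbound : ∀ ξ : E d, ‖(∫ x in box d L, expo (ξ - p) x) * A ξ‖ ≤
      ((L + 1) ^ d * ∏ j, (1 + |p j|)⁻¹) * ((1 + ‖ξ‖) ^ d * ‖A ξ‖) := by
    intro ξ
    rw [norm_mul, ← mul_assoc]
    refine mul_le_mul_of_nonneg_right ?_ (norm_nonneg _)
    rw [setIntegral_expo_eq_prod, norm_prod]
    have hj : ∀ j : Fin d, ‖∫ t in Set.Ico (-(L / 2)) (L / 2),
        Complex.exp (2 * Real.pi * Complex.I * ((ξ - p) j * t : ℝ))‖ ≤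
          (L + 1) * (1 + |p j|)⁻¹ * (1 + ‖ξ‖) := by
      intro j
      refine (norm_setIntegral_exp_mul_le hL _).trans ?_
      have hξ : |ξ j| ≤ ‖ξ‖ := PiLp.norm_apply_le ξ j
      have hp : |p j| ≤ |ξ j| + |(ξ - p) j| := by
        have := abs_sub_abs_le_abs_sub (p j) (ξ j)
        rw [abs_sub_comm] at this
        simp only [PiLp.sub_apply]
        linarith
      have h0 := abs_nonneg ((ξ - p) j)
      have h1 := abs_nonneg (p j)
      have h2 := norm_nonneg ξ
      rw [div_le_iff₀ (by positivity), mul_assoc, mul_assoc]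
      -- What remains is `1 + |p_j| ≤ (1 + ‖ξ‖) (1 + |(ξ - p)_j|)`, a consequence of the triangle
      -- inequality.
      refine le_mul_of_one_le_right (by linarith) ?_
      rw [inv_mul_eq_div, one_le_div (by positivity)]
      nlinarith
    refine (Finset.prod_le_prod (fun j _ => norm_nonneg _) fun j _ => hj j).trans (le_of_eq ?_)
    simp [Finset.prod_mul_distrib]
  rw [h2]
  refine (norm_integral_le_of_norm_le (hAint.const_mul _)
    (Filter.Eventually.of_forall hbound)).trans ?_
  rw [integral_const_mul]
  have hP : 0 ≤ ∏ j, (1 + |p j|)⁻¹ := Finset.prod_nonneg fun j _ => by positivity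
  nlinarith

/-! ### Summable weights on the dual lattice -/

lemma tsum_pi_prod {ι : Type*} (f : ι → ENNReal) (d : ℕ) :
    ∑' m : Fin d → ι, ∏ j, f (m j) = (∑' i, f i) ^ d := by
  induction d with
  | zero => simp
  | succ d ih =>
    rw [← (Fin.consEquiv fun _ => ι).tsum_eq]
    simp only [Fin.consEquiv_apply, Fin.prod_univ_succ, Fin.cons_zero, Fin.cons_succ]
    rw [ENNReal.tsum_prod (f := fun (a : ι) (b : Fin d → ι) => f a * ∏ j, f (b j))]
    simp only [ENNReal.tsum_mul_left, ih, ENNReal.tsum_mul_right]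
    rw [pow_succ, mul_comm]

/-- The summable weight `∏_j (1 + |p_j|)^{-s}` on momentum space. -/
def productWeight {d : ℕ} (s : ℝ) (p : E d) : ℝ := ∏ j, (1 + |p j|) ^ (-s)

lemma productWeight_nonneg {d : ℕ} (s : ℝ) (p : E d) : 0 ≤ productWeight s p :=
  Finset.prod_nonneg fun j _ => by positivity

lemma productWeight_neg {d : ℕ} (s : ℝ) (p : E d) : productWeight s (-p) = productWeight s p := by
  simp [productWeight]

lemma summable_one_add_abs_div_rpow {L : ℝ} (hL : 0 < L) {s : ℝ} (hs : 1 < s) :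
    Summable fun m : ℤ => (1 + |(m : ℝ) / L|) ^ (-s) := by
  -- The shift by `1 / 2` keeps the base nonzero for every integer, and the factor `min 1 L⁻¹`
  -- absorbs the lattice spacing.
  have h := ((Real.summable_one_div_int_add_rpow (1 / 2) s).2 hs).mul_left ((min 1 L⁻¹) ^ (-s))
  refine Summable.of_nonneg_of_le (fun m => by positivity) (fun m => ?_) h
  have hc : 0 < min 1 L⁻¹ := lt_min one_pos (inv_pos.2 hL)
  have hne : 0 < |(m : ℝ) + 1 / 2| := by
    rw [abs_pos]
    intro h0
    have : (2 * m + 1 : ℝ) = 0 := by linarith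
    have : 2 * m + 1 = 0 := by exact_mod_cast this
    omega
  rw [one_div, ← Real.rpow_neg (abs_nonneg _), ← Real.mul_rpow hc.le (abs_nonneg _)]
  refine Real.rpow_le_rpow_of_nonpos (by positivity) ?_ (by linarith)
  rw [abs_div, abs_of_pos hL, div_eq_mul_inv]
  have h1 : |(m : ℝ) + 1 / 2| ≤ |(m : ℝ)| + 1 := by
    refine (abs_add_le _ _).trans ?_
    norm_num
  calc min 1 L⁻¹ * |(m : ℝ) + 1 / 2| ≤ min 1 L⁻¹ * (|(m : ℝ)| + 1) :=
        mul_le_mul_of_nonneg_left h1 hc.le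
    _ = min 1 L⁻¹ + |(m : ℝ)| * min 1 L⁻¹ := by ring
    _ ≤ _ := add_le_add (min_le_left _ _) (mul_le_mul_of_nonneg_left (min_le_right _ _)
        (abs_nonneg _))

lemma tsum_productWeight_ne_top (d : ℕ) {L : ℝ} (hL : 0 < L) {s : ℝ} (hs : 1 < s) :
    ∑' p : dualLattice d L, ENNReal.ofReal (productWeight s (p : E d)) ≠ ⊤ := by
  rw [← (latticeEquiv d hL).tsum_eq]
  have h : ∀ m : Fin d → ℤ, ENNReal.ofReal (productWeight s (latticeEquiv d hL m : E d)) =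
      ∏ j, ENNReal.ofReal ((1 + |(m j : ℝ) / L|) ^ (-s)) := fun m => by
    rw [coe_latticeEquiv, productWeight, ENNReal.ofReal_prod_of_nonneg fun j _ => by positivity]
    rfl
  simp only [h]
  rw [tsum_pi_prod fun m : ℤ => ENNReal.ofReal ((1 + |(m : ℝ) / L|) ^ (-s))]
  exact ENNReal.pow_ne_top (summable_one_add_abs_div_rpow hL hs).tsum_ofReal_ne_top

/-- The reflection `l ↦ k - l` of the dual lattice. -/
def latticeReflection {d : ℕ} {L : ℝ} (k : dualLattice d L) : Equiv.Perm (dualLattice d L) :=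
  Function.Involutive.toPerm (fun l => ⟨(k : E d) - l, sub_mem_dualLattice k.2 l.2⟩)
    fun l => Subtype.ext (sub_sub_cancel (k : E d) l)

lemma tsum_productWeight_sub {d : ℕ} {L : ℝ} (s : ℝ) (k : dualLattice d L) :
    ∑' l : dualLattice d L, ENNReal.ofReal (productWeight s ((k : E d) - (l : E d))) =
      ∑' l : dualLattice d L, ENNReal.ofReal (productWeight s (l : E d)) :=
  (latticeReflection k).tsum_eq fun l : dualLattice d L => ENNReal.ofReal (productWeight s (l : E d))

/-- Young's inequality turns the product of the profile and the resolvent into summable weights. -/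
lemma exists_norm_profileCoeff_mul_le {d : ℕ} {L : ℝ} (hL : 0 < L) (B : 𝓢(E d, ℝ)) {z : ℂ}
    (hz : ∀ t : ℝ, 0 ≤ t → z ≠ (t : ℂ)) :
    ∃ (C s : ℝ), 0 ≤ C ∧ 1 < s ∧ ∀ p l : E d,
      ‖profileCoeff L B p‖ * ‖((nu l : ℂ) - z)⁻¹‖ ≤ C * (productWeight s p + productWeight s l) := by
  obtain ⟨Cb, hCb, hb⟩ := exists_norm_profileCoeff_le hL B
  obtain ⟨Cr, hCr, hr⟩ := exists_one_add_le_mul_norm_sub hz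
  -- Since `q > 1`, the `q`-th power of the profile decay is a summable weight. The conjugate
  -- exponent `q' = d + 2` satisfies `q' / (d + 1) = q`, so a resolvent decay `∏ (1 + |l_j|) ^ (-1 /
  -- (d + 1))` turns into the same weight.
  set q : ℝ := (d + 2) / (d + 1) with hq
  set q' : ℝ := d + 2 with hq'
  have hd : (0 : ℝ) ≤ d := Nat.cast_nonneg d
  have hq1 : 1 < q := by rw [hq, lt_div_iff₀ (by positivity)]; linarith
  have hq'1 : 1 < q' := by rw [hq']; linarith
  have hconj : q.HolderConjugate q' := by
    rw [Real.holderConjugate_iff]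
    refine ⟨hq1, ?_⟩
    rw [hq, hq']
    field_simp
    ring
  refine ⟨Cb ^ q + (4 * Cr) ^ q', q, by positivity, hq1, fun p l => ?_⟩
  have hpw : (∏ j, (1 + |p j|)⁻¹) ^ q = productWeight q p := by
    rw [productWeight, ← Real.finsetProd_rpow _ _ fun j _ => by positivity]
    refine Finset.prod_congr rfl fun j _ => ?_
    rw [Real.rpow_neg (by positivity), Real.inv_rpow (by positivity)]
  have hbq : ‖profileCoeff L B p‖ ^ q ≤ Cb ^ q * productWeight q p := by
    rw [← hpw, ← Real.mul_rpow hCb.le (Finset.prod_nonneg fun j _ => by positivity)]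
    exact Real.rpow_le_rpow (norm_nonneg _) (hb p) (by linarith)
  have hnu := nu_nonneg l
  -- Each of the `d` factors is at most `(4 (1 + ν)) ^ (1 / (d + 1))`, and the total exponent `d /
  -- (d + 1)` does not exceed `1`.
  have hprod : ∏ j, (1 + |l j|) ^ (1 / (d + 1 : ℝ)) ≤ 4 * (1 + nu l) := by
    have hj : ∀ j, 1 + |l j| ≤ 4 * (1 + nu l) := fun j => by
      have h1 : |l j| ≤ ‖l‖ := PiLp.norm_apply_le l j
      have h2 : nu l = 1 / 2 * ‖l‖ ^ 2 := rfl
      nlinarith [sq_nonneg (‖l‖ - 1)]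
    calc ∏ j, (1 + |l j|) ^ (1 / (d + 1 : ℝ))
        ≤ ∏ _j : Fin d, (4 * (1 + nu l)) ^ (1 / (d + 1 : ℝ)) :=
          Finset.prod_le_prod (fun j _ => by positivity) fun j _ =>
            Real.rpow_le_rpow (by positivity) (hj j) (by positivity)
      _ = (4 * (1 + nu l)) ^ (1 / (d + 1 : ℝ) * d) := by
          rw [Finset.prod_const, Finset.card_univ, Fintype.card_fin, Real.rpow_mul (by positivity),
            Real.rpow_natCast]
      _ ≤ (4 * (1 + nu l)) ^ (1 : ℝ) := by
          refine Real.rpow_le_rpow_of_exponent_le (by linarith) ?_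
          rw [one_div_mul_eq_div, div_le_one (by positivity)]
          linarith
      _ = _ := Real.rpow_one _
  have hP : 0 < ∏ j, (1 + |l j|) ^ (1 / (d + 1 : ℝ)) := Finset.prod_pos fun j _ => by positivity
  have hr1 : ‖((nu l : ℂ) - z)⁻¹‖ ≤ 4 * Cr * (∏ j, (1 + |l j|) ^ (1 / (d + 1 : ℝ)))⁻¹ := by
    refine (norm_inv_nu_sub_le hCr hr l).trans ?_
    rw [div_le_iff₀ (by linarith), ← div_eq_mul_inv, div_mul_eq_mul_div, le_div_iff₀ hP]
    nlinarith
  have hrq : ‖((nu l : ℂ) - z)⁻¹‖ ^ q' ≤ (4 * Cr) ^ q' * productWeight q l := by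
    have hpw' : ((∏ j, (1 + |l j|) ^ (1 / (d + 1 : ℝ)))⁻¹) ^ q' = productWeight q l := by
      rw [productWeight, ← Finset.prod_inv_distrib,
        ← Real.finsetProd_rpow _ _ fun j _ => by positivity]
      refine Finset.prod_congr rfl fun j _ => ?_
      rw [← Real.rpow_neg (by positivity), ← Real.rpow_mul (by positivity)]
      congr 1
      rw [hq, hq']
      field_simp
    rw [← hpw', ← Real.mul_rpow (by positivity) (by positivity)]
    exact Real.rpow_le_rpow (norm_nonneg _) hr1 (by linarith)
  have hy := Real.young_inequality_of_nonneg (norm_nonneg (profileCoeff L B p))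
    (norm_nonneg ((nu l : ℂ) - z)⁻¹) hconj
  have h1 : ‖profileCoeff L B p‖ ^ q / q ≤ ‖profileCoeff L B p‖ ^ q :=
    div_le_self (by positivity) hq1.le
  have h2 : ‖((nu l : ℂ) - z)⁻¹‖ ^ q' / q' ≤ ‖((nu l : ℂ) - z)⁻¹‖ ^ q' :=
    div_le_self (by positivity) hq'1.le
  have w1 := productWeight_nonneg q p
  have w2 := productWeight_nonneg q l
  have c1 : 0 ≤ Cb ^ q * productWeight q l := by positivity
  have c2 : 0 ≤ (4 * Cr) ^ q' * productWeight q p := by positivity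
  nlinarith

/-- Summing the product of the profile and the resolvent over one momentum gives a uniformly bounded
result. -/
lemma exists_tsum_profileCoeff_mul_le {d : ℕ} {L : ℝ} (hL : 0 < L) (B : 𝓢(E d, ℝ)) {z : ℂ}
    (hz : ∀ t : ℝ, 0 ≤ t → z ≠ (t : ℂ)) :
    ∃ C : ENNReal, C ≠ ⊤ ∧ ∀ k : dualLattice d L,
      ∑' l : dualLattice d L, ‖profileCoeff L B ((k : E d) - l)‖ₑ * ‖((nu (l : E d) : ℂ) - z)⁻¹‖ₑ ≤ C ∧
      ∑' l : dualLattice d L, ‖profileCoeff L B ((l : E d) - k)‖ₑ * ‖((nu (l : E d) : ℂ) - z)⁻¹‖ₑ ≤ C := by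
  obtain ⟨C, s, hC, hs, h⟩ := exists_norm_profileCoeff_mul_le hL B hz
  set S := ∑' p : dualLattice d L, ENNReal.ofReal (productWeight s (p : E d)) with hS
  have hStop : S ≠ ⊤ := tsum_productWeight_ne_top d hL hs
  refine ⟨ENNReal.ofReal C * (S + S),
    ENNReal.mul_ne_top ENNReal.ofReal_ne_top (ENNReal.add_ne_top.2 ⟨hStop, hStop⟩), fun k => ?_⟩
  have hle : ∀ p l : E d, ‖profileCoeff L B p‖ₑ * ‖((nu l : ℂ) - z)⁻¹‖ₑ ≤
      ENNReal.ofReal C * (ENNReal.ofReal (productWeight s p) + ENNReal.ofReal (productWeight s l)) := by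
    intro p l
    rw [← enorm_mul, ← ofReal_norm, ← ENNReal.ofReal_add (productWeight_nonneg s p)
      (productWeight_nonneg s l), ← ENNReal.ofReal_mul hC]
    refine ENNReal.ofReal_le_ofReal ?_
    rw [norm_mul]
    exact h p l
  have hsum : ∑' l : dualLattice d L, ENNReal.ofReal C *
      (ENNReal.ofReal (productWeight s ((k : E d) - (l : E d))) + ENNReal.ofReal (productWeight s (l : E d))) =
        ENNReal.ofReal C * (S + S) := by
    rw [ENNReal.tsum_mul_left, ENNReal.tsum_add, tsum_productWeight_sub]
  constructor
  · exact (ENNReal.tsum_le_tsum fun l => hle _ _).trans hsum.le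
  · refine (ENNReal.tsum_le_tsum fun l => hle _ _).trans (le_of_eq ?_)
    rw [← hsum]
    refine tsum_congr fun l => ?_
    rw [← productWeight_neg s ((k : E d) - (l : E d)), neg_sub]

/-! ### Absolute summability of sums over chains -/

lemma prod_snoc_vertex {ι M : Type*} [CommMonoid M] {n : ℕ} (r : ι → M) (f : Fin (n + 1) → ι)
    (x : ι) : ∏ j : Fin (n + 2), r ((Fin.snoc f x : Fin (n + 2) → ι) j) = (∏ j, r (f j)) * r x := by
  rw [Fin.prod_univ_castSucc]
  simp

lemma prod_snoc_edge {ι M : Type*} [CommMonoid M] {n : ℕ} (b : ι → ι → M) (f : Fin (n + 1) → ι)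
    (x : ι) : ∏ l : Fin (n + 1), b ((Fin.snoc f x : Fin (n + 2) → ι) l.castSucc)
        ((Fin.snoc f x : Fin (n + 2) → ι) l.succ) =
      (∏ l : Fin n, b (f l.castSucc) (f l.succ)) * b (f (Fin.last n)) x := by
  rw [Fin.prod_univ_castSucc]
  simp only [Fin.succ_castSucc, Fin.succ_last, Fin.snoc_castSucc, Fin.snoc_last]

lemma snoc_zero {ι : Type*} {n : ℕ} (f : Fin (n + 1) → ι) (x : ι) :
    (Fin.snoc f x : Fin (n + 2) → ι) 0 = f 0 :=
  Fin.snoc_castSucc (α := fun _ => ι) x f 0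

/-- Summing out the last vertices of a chain one by one. -/
lemma tsum_chain_le {ι : Type*} (φ r : ι → ENNReal) (b : ι → ι → ENNReal) {C : ENNReal}
    (h : ∀ k, ∑' l, b k l * r l ≤ C) (n : ℕ) :
    ∑' k : Fin (n + 1) → ι, φ (k 0) *
      ((∏ j, r (k j)) * ∏ l : Fin n, b (k l.castSucc) (k l.succ)) ≤ C ^ n * ∑' i, φ i * r i := by
  induction n with
  | zero =>
    rw [← (Equiv.funUnique (Fin 1) ι).symm.tsum_eq]
    simp
  | succ n ih =>
    rw [← ((Equiv.prodComm _ _).trans (Fin.snocEquiv fun _ => ι)).tsum_eq, ENNReal.tsum_prod']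
    have hterm : ∀ (f : Fin (n + 1) → ι), ∑' x : ι,
        (fun k : Fin (n + 2) → ι => φ (k 0) *
          ((∏ j, r (k j)) * ∏ l : Fin (n + 1), b (k l.castSucc) (k l.succ)))
          (((Equiv.prodComm _ _).trans (Fin.snocEquiv fun _ => ι)) (f, x)) ≤
        C * (φ (f 0) * ((∏ j, r (f j)) * ∏ l : Fin n, b (f l.castSucc) (f l.succ))) := by
      intro f
      have hx : ∀ x : ι, (fun k : Fin (n + 2) → ι => φ (k 0) *
          ((∏ j, r (k j)) * ∏ l : Fin (n + 1), b (k l.castSucc) (k l.succ)))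
          (((Equiv.prodComm _ _).trans (Fin.snocEquiv fun _ => ι)) (f, x)) =
          (φ (f 0) * ((∏ j, r (f j)) * ∏ l : Fin n, b (f l.castSucc) (f l.succ))) *
            (b (f (Fin.last n)) x * r x) := by
        intro x
        simp only [Equiv.trans_apply, Equiv.prodComm_apply, Prod.swap_prod_mk,
          Fin.snocEquiv_apply]
        rw [prod_snoc_vertex, prod_snoc_edge, snoc_zero]
        ring
      simp only [hx]
      rw [ENNReal.tsum_mul_left, mul_comm]
      exact mul_le_mul_left (h _) _
    refine (ENNReal.tsum_le_tsum hterm).trans ?_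
    rw [ENNReal.tsum_mul_left, pow_succ', mul_assoc]
    exact mul_le_mul_right ih _

/-- Summing out the first vertices of a chain one by one. -/
lemma tsum_chain_le' {ι : Type*} (ψ r : ι → ENNReal) (b : ι → ι → ENNReal) {C : ENNReal}
    (h : ∀ k, ∑' l, b l k * r l ≤ C) (n : ℕ) :
    ∑' k : Fin (n + 1) → ι, ψ (k (Fin.last n)) *
      ((∏ j, r (k j)) * ∏ l : Fin n, b (k l.castSucc) (k l.succ)) ≤ C ^ n * ∑' i, ψ i * r i := by
  refine le_trans (le_of_eq ?_) (tsum_chain_le ψ r (fun x y => b y x) h n)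
  -- Reversing the chain exchanges its ends and the two arguments of `b`.
  rw [← (Equiv.arrowCongr Fin.revPerm (Equiv.refl ι)).tsum_eq]
  refine tsum_congr fun k => ?_
  simp only [Equiv.arrowCongr_apply, Equiv.coe_refl, Function.comp, id, Fin.revPerm_symm,
    Fin.revPerm_apply, Fin.rev_last]
  congr 2
  · exact Equiv.prod_comp Fin.revPerm fun j => r (k j)
  · rw [← Equiv.prod_comp Fin.revPerm]
    refine Finset.prod_congr rfl fun l _ => ?_
    simp [Fin.rev_castSucc, Fin.rev_succ]

/-- The inequality `φ ψ ≤ φ² + ψ²` decouples the two ends. In each half the vertices are summed out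
towards the end carrying the square, where `r ≤ R` leaves an `ℓ²` norm; this is why the edge bound
is needed in both directions. -/
lemma tsum_chain_lt_top {ι : Type*} {φ ψ r : ι → ENNReal} {b : ι → ι → ENNReal} {C R : ENNReal}
    (hC : C ≠ ⊤) (hR : R ≠ ⊤) (h : ∀ k, ∑' l, b k l * r l ≤ C) (h' : ∀ k, ∑' l, b l k * r l ≤ C)
    (hr : ∀ i, r i ≤ R) (hφ : ∑' i, φ i ^ 2 ≠ ⊤) (hψ : ∑' i, ψ i ^ 2 ≠ ⊤) (n : ℕ) :
    ∑' k : Fin (n + 1) → ι, φ (k 0) * ψ (k (Fin.last n)) *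
      ((∏ j, r (k j)) * ∏ l : Fin n, b (k l.castSucc) (k l.succ)) ≠ ⊤ := by
  have hfin : ∀ f : ι → ENNReal, ∑' i, f i ^ 2 ≠ ⊤ → C ^ n * ∑' i, f i ^ 2 * r i ≠ ⊤ := by
    intro f hf
    refine ENNReal.mul_ne_top (ENNReal.pow_ne_top hC) ?_
    refine ne_top_of_le_ne_top (ENNReal.mul_ne_top hf hR) ?_
    rw [← ENNReal.tsum_mul_right]
    exact ENNReal.tsum_le_tsum fun i => mul_le_mul_right (hr i) _
  refine ne_top_of_le_ne_top (ENNReal.add_ne_top.2 ⟨hfin φ hφ, hfin ψ hψ⟩) ?_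
  refine le_trans ?_ (add_le_add (tsum_chain_le (fun i => φ i ^ 2) r b h n)
    (tsum_chain_le' (fun i => ψ i ^ 2) r b h' n))
  rw [← ENNReal.tsum_add]
  refine ENNReal.tsum_le_tsum fun k => ?_
  rw [← add_mul]
  refine mul_le_mul_left ?_ _
  rcases le_total (φ (k 0)) (ψ (k (Fin.last n))) with hle | hle
  · exact (mul_le_mul_left hle _).trans (by rw [← sq]; exact le_add_self)
  · exact (mul_le_mul_right hle _).trans (by rw [← sq]; exact le_self_add)

/-- The deterministic part of the momentum space expansion of the matrix element. -/
def chainTerm {d : ℕ} {L : ℝ} (B : 𝓢(E d, ℝ)) {n : ℕ} (z : ℂ) (f₁ f₂ : L2Box d L)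
    (k : Fin (n + 1) → dualLattice d L) : ℂ :=
  starRingEnd ℂ (fourierCoeff L f₁ (k 0)) * fourierCoeff L f₂ (k (Fin.last n)) *
    ((∏ j : Fin (n + 1), ((nu (k j : E d) : ℂ) - z)⁻¹) *
      ∏ l : Fin n, profileCoeff L B ((k l.castSucc : E d) - (k l.succ : E d)))

lemma summable_norm_of_tsum_enorm_ne_top {ι : Type*} {f : ι → ℂ} (h : ∑' i, ‖f i‖ₑ ≠ ⊤) :
    Summable fun i => ‖f i‖ := by
  have h2 : Summable fun i => ‖f i‖₊ := ENNReal.tsum_coe_ne_top_iff_summable.1 h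
  exact NNReal.summable_coe.2 h2

lemma tsum_enorm_fourierCoeff_sq_ne_top {d : ℕ} {L : ℝ} (hL : 0 < L) (f : L2Box d L) :
    ∑' p : dualLattice d L, ‖fourierCoeff L f p‖ₑ ^ 2 ≠ ⊤ := by
  have hs := (memℓp_gen_iff (by norm_num)).1 (memℓp_fourierCoeff hL f)
  have h2 := hs.tsum_ofReal_ne_top
  convert h2 using 4 with p
  simp only [ENNReal.toReal_ofNat, Real.rpow_two]
  rw [ENNReal.ofReal_pow (norm_nonneg _), ofReal_norm]

/-- Supplies the bound, independent of the configuration, behind every exchange of sums and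
expectations. -/
lemma summable_norm_chainTerm {d : ℕ} {L : ℝ} (hL : 0 < L) (B : 𝓢(E d, ℝ)) (n : ℕ) {z : ℂ}
    (hz : ∀ t : ℝ, 0 ≤ t → z ≠ (t : ℂ)) (f₁ f₂ : L2Box d L) :
    Summable fun k : Fin (n + 1) → dualLattice d L => ‖chainTerm B z f₁ f₂ k‖ := by
  obtain ⟨C, hC, hb⟩ := exists_tsum_profileCoeff_mul_le hL B hz
  obtain ⟨R, hR, hRz⟩ := exists_one_add_le_mul_norm_sub hz
  have hRle : ∀ p : E d, ‖((nu p : ℂ) - z)⁻¹‖ ≤ R := fun p =>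
    (norm_inv_nu_sub_le hR hRz p).trans (div_le_self hR.le (by linarith [nu_nonneg p]))
  refine summable_norm_of_tsum_enorm_ne_top ?_
  refine ne_of_eq_of_ne (tsum_congr fun k => ?_) (tsum_chain_lt_top (n := n)
    (φ := fun p : dualLattice d L => ‖fourierCoeff L f₁ p‖ₑ)
    (ψ := fun p : dualLattice d L => ‖fourierCoeff L f₂ p‖ₑ)
    (r := fun p : dualLattice d L => ‖((nu (p : E d) : ℂ) - z)⁻¹‖ₑ)
    (b := fun k l : dualLattice d L => ‖profileCoeff L B ((k : E d) - (l : E d))‖ₑ)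
    (R := ENNReal.ofReal R) hC ENNReal.ofReal_ne_top (fun k => (hb k).1) (fun k => (hb k).2)
    (fun p => ?_) (tsum_enorm_fourierCoeff_sq_ne_top hL f₁)
    (tsum_enorm_fourierCoeff_sq_ne_top hL f₂))
  · rw [← ofReal_norm, chainTerm, norm_mul, norm_mul, norm_mul, RCLike.norm_conj, norm_prod,
      norm_prod, ENNReal.ofReal_mul (by positivity), ENNReal.ofReal_mul (norm_nonneg _),
      ENNReal.ofReal_mul (Finset.prod_nonneg fun _ _ => norm_nonneg _),
      ENNReal.ofReal_prod_of_nonneg fun _ _ => norm_nonneg _,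
      ENNReal.ofReal_prod_of_nonneg fun _ _ => norm_nonneg _]
    simp only [ofReal_norm]
  · rw [← ofReal_norm]
    exact ENNReal.ofReal_le_ofReal (hRle p)

/-! ### Momentum expansion for a fixed configuration -/

/-- The total variation `∑_{γ < M} |v_γ|` of a configuration. -/
def totalWeight {d : ℕ} (ω : Config d) : ℝ := ∑ γ ∈ Finset.range ω.1, |ω.2.2 γ|

lemma totalWeight_nonneg {d : ℕ} (ω : Config d) : 0 ≤ totalWeight ω :=
  Finset.sum_nonneg fun _ _ => abs_nonneg _

lemma norm_structureFactor_le {d : ℕ} (ω : Config d) (p : E d) :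
    ‖structureFactor ω p‖ ≤ totalWeight ω := by
  refine (norm_sum_le _ _).trans (Finset.sum_le_sum fun γ _ => le_of_eq ?_)
  rw [norm_mul, norm_expo, mul_one, Complex.norm_real, Real.norm_eq_abs]

/-- The random part of the momentum space expansion of the matrix element. -/
def structureProd {d : ℕ} {L : ℝ} {n : ℕ} (ω : Config d) (k : Fin (n + 1) → dualLattice d L) : ℂ :=
  ∏ l : Fin n, structureFactor ω ((k l.castSucc : E d) - (k l.succ : E d))

lemma norm_structureProd_le {d : ℕ} {L : ℝ} {n : ℕ} (ω : Config d)
    (k : Fin (n + 1) → dualLattice d L) : ‖structureProd ω k‖ ≤ totalWeight ω ^ n := by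
  rw [structureProd, norm_prod]
  refine (Finset.prod_le_prod (fun _ _ => norm_nonneg _)
    fun l _ => norm_structureFactor_le ω _).trans (le_of_eq ?_)
  simp

lemma summable_chainTerm_mul_structureProd {d : ℕ} {L : ℝ} (hL : 0 < L) (B : 𝓢(E d, ℝ)) (n : ℕ)
    {z : ℂ} (hz : ∀ t : ℝ, 0 ≤ t → z ≠ (t : ℂ)) (f₁ f₂ : L2Box d L) (ω : Config d) :
    Summable fun k : Fin (n + 1) → dualLattice d L => chainTerm B z f₁ f₂ k * structureProd ω k := by
  refine Summable.of_norm_bounded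
    ((summable_norm_chainTerm hL B n hz f₁ f₂).mul_right (totalWeight ω ^ n)) fun k => ?_
  rw [norm_mul]
  exact mul_le_mul_of_nonneg_left (norm_structureProd_le ω k) (norm_nonneg _)

/-- The momentum space expansion of the matrix element for a fixed configuration. -/
lemma inner_freeResolvent_iterate {d : ℕ} {L : ℝ} (hL : 0 < L) (B : 𝓢(E d, ℝ)) (n : ℕ)
    {z : ℂ} (hz : ∀ t : ℝ, 0 ≤ t → z ≠ (t : ℂ)) (f₁ f₂ : L2Box d L) (ω : Config d) :
    inner ℂ f₁ (freeResolvent z ((fun f => potentialOp B ω (freeResolvent z f))^[n] f₂)) =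
      ((boxVol d L : ℂ)⁻¹) ^ (n + 1) *
        ∑' k : Fin (n + 1) → dualLattice d L, chainTerm B z f₁ f₂ k * structureProd ω k := by
  -- The innermost factor `V R` is absorbed into `f₂`, which therefore has to vary.
  induction n generalizing f₂ with
  | zero =>
    rw [← (Equiv.funUnique (Fin 1) (dualLattice d L)).symm.tsum_eq, Function.iterate_zero, id,
      ← (hasSum_fourierCoeff hL _ _).tsum_eq, tsum_mul_left, zero_add, pow_one]
    congr 1
    refine tsum_congr fun p => ?_
    rw [fourierCoeff_freeResolvent hL hz]
    simp only [chainTerm, structureProd, Finset.prod_const, Finset.card_univ, Fintype.card_fin,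
      Equiv.funUnique_symm_apply, uniqueElim_const, zero_add, pow_one, pow_zero, mul_one]
    ring
  | succ n ih =>
    have hsum := summable_chainTerm_mul_structureProd hL B (n + 1) hz f₁ f₂ ω
    let e : (Fin (n + 1) → dualLattice d L) × dualLattice d L ≃ (Fin (n + 2) → dualLattice d L) :=
      (Equiv.prodComm _ _).trans (Fin.snocEquiv fun _ => dualLattice d L)
    -- Absolute convergence allows the last momentum to be summed separately; that inner sum is the
    -- convolution produced by one potential.
    have hprod : ∑' k : Fin (n + 2) → dualLattice d L, chainTerm B z f₁ f₂ k * structureProd ω k =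
        ∑' k : Fin (n + 1) → dualLattice d L, ∑' x : dualLattice d L,
          chainTerm B z f₁ f₂ (e (k, x)) * structureProd ω (e (k, x)) := by
      rw [← e.tsum_eq]
      exact (e.summable_iff.2 hsum).tsum_prod
    rw [Function.iterate_succ_apply, ih, hprod, pow_succ _ (n + 1), mul_assoc]
    congr 1
    rw [← tsum_mul_left]
    refine tsum_congr fun k => ?_
    rw [chainTerm, ← (hasSum_fourierCoeff_potentialOp hL B ω (freeResolvent z f₂)
      (k (Fin.last n))).tsum_eq, tsum_mul_left]
    have hterm : ∀ x : dualLattice d L,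
        chainTerm B z f₁ f₂ (e (k, x)) * structureProd ω (e (k, x)) =
        (starRingEnd ℂ (fourierCoeff L f₁ (k 0)) *
          ((∏ j : Fin (n + 1), ((nu (k j : E d) : ℂ) - z)⁻¹) *
          ∏ l : Fin n, profileCoeff L B ((k l.castSucc : E d) - (k l.succ : E d))) *
          structureProd ω k) *
        (structureFactor ω ((k (Fin.last n) : E d) - x) *
          profileCoeff L B ((k (Fin.last n) : E d) - x) * fourierCoeff L (freeResolvent z f₂) x) := by
      intro x
      have he : e (k, x) = (Fin.snoc k x : Fin (n + 2) → dualLattice d L) := rfl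
      rw [fourierCoeff_freeResolvent hL hz, he, chainTerm, structureProd, structureProd,
        prod_snoc_vertex (fun p : dualLattice d L => ((nu (p : E d) : ℂ) - z)⁻¹),
        prod_snoc_edge (fun p q : dualLattice d L => profileCoeff L B ((p : E d) - (q : E d))),
        prod_snoc_edge (fun p q : dualLattice d L => structureFactor ω ((p : E d) - (q : E d))),
        snoc_zero, Fin.snoc_last]
      ring
    simp only [hterm]
    rw [tsum_mul_left]
    ring

/-! ### Set partitions as fiber partitions of maps -/

section Partitions

variable {n : ℕ} {κ : Type*}

open Classical in
/-- The partition of `Fin n` into the fibers of a map. -/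
def fiberPartition (g : Fin n → κ) : Finpartition (Finset.univ : Finset (Fin n)) :=
  Finpartition.ofSetoid (Setoid.ker g)

lemma mem_part_fiberPartition {g : Fin n → κ} {x y : Fin n} :
    y ∈ (fiberPartition g).part x ↔ g x = g y := by
  classical
  exact Finpartition.mem_part_ofSetoid_iff_rel

lemma exists_part_eq {A : Finpartition (Finset.univ : Finset (Fin n))} {a : Finset (Fin n)}
    (ha : a ∈ A.parts) : ∃ x ∈ a, A.part x = a := by
  obtain ⟨x, hx⟩ := A.nonempty_of_mem_parts ha
  exact ⟨x, hx, A.part_eq_of_mem ha hx⟩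

lemma part_mem_parts (A : Finpartition (Finset.univ : Finset (Fin n))) (x : Fin n) :
    A.part x ∈ A.parts := A.part_mem.2 (Finset.mem_univ x)

lemma finpartition_ext {A A' : Finpartition (Finset.univ : Finset (Fin n))}
    (h : ∀ x, A.part x = A'.part x) : A = A' := by
  refine Finpartition.ext (Finset.ext fun a => ⟨fun ha => ?_, fun ha => ?_⟩)
  · obtain ⟨x, -, rfl⟩ := exists_part_eq ha
    rw [h]
    exact part_mem_parts _ _
  · obtain ⟨x, -, rfl⟩ := exists_part_eq ha
    rw [← h]
    exact part_mem_parts _ _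

/-- The blocks are the fibers over the image, and on the image distinct points have distinct fibers,
so the product may be reindexed. -/
lemma prod_parts_fiberPartition [DecidableEq κ] {M : Type*} [CommMonoid M] (g : Fin n → κ)
    (c : Finset (Fin n) → M) :
    ∏ a ∈ (fiberPartition g).parts, c a =
      ∏ i ∈ Finset.univ.image g, c (Finset.univ.filter fun x => g x = i) := by
  have hpart : ∀ x, (fiberPartition g).part x = Finset.univ.filter fun y => g y = g x := by
    intro x
    ext y
    rw [mem_part_fiberPartition]
    simp [eq_comm]
  have hparts : (fiberPartition g).parts =
      (Finset.univ.image g).image fun i => Finset.univ.filter fun x => g x = i := by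
    ext a
    simp only [Finset.image_image, Finset.mem_image, Finset.mem_univ, true_and, Function.comp]
    constructor
    · intro ha
      obtain ⟨x, -, hx⟩ := exists_part_eq ha
      exact ⟨x, by rw [← hpart, hx]⟩
    · rintro ⟨x, rfl⟩
      rw [← hpart]
      exact part_mem_parts _ _
  rw [hparts, Finset.prod_image]
  intro i hi j _ hij
  obtain ⟨x, -, rfl⟩ := Finset.mem_image.1 hi
  have : x ∈ Finset.univ.filter fun y => g y = j := by
    have hx : x ∈ Finset.univ.filter fun y => g y = g x := by simp
    exact (Finset.ext_iff.1 hij x).1 hx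
  exact (Finset.mem_filter.1 this).2

/-- Maps with a prescribed fiber partition correspond to embeddings of its set of blocks. -/
lemma bijective_comp_part (A : Finpartition (Finset.univ : Finset (Fin n))) :
    Function.Bijective fun e : (A.parts ↪ κ) =>
      (⟨fun x => e ⟨A.part x, part_mem_parts A x⟩, finpartition_ext fun x => by
        ext y
        rw [mem_part_fiberPartition, e.injective.eq_iff, Subtype.mk.injEq,
          A.mem_part_iff_part_eq_part (Finset.mem_univ _) (Finset.mem_univ _), eq_comm]⟩ :
        {g : Fin n → κ // fiberPartition g = A}) := by
  constructor
  · intro e e' h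
    ext ⟨a, ha⟩
    obtain ⟨x, -, rfl⟩ := exists_part_eq ha
    exact congrFun (congrArg Subtype.val h) x
  · rintro ⟨g, rfl⟩
    choose x hxmem hx using fun a : (fiberPartition g).parts => exists_part_eq a.2
    refine ⟨⟨fun a => g (x a), fun a b hab => ?_⟩, Subtype.ext (funext fun y => ?_)⟩
    · refine Subtype.ext ?_
      rw [← hx a, ← hx b]
      ext y
      rw [mem_part_fiberPartition, mem_part_fiberPartition]
      simp only at hab
      rw [hab]
    · exact (mem_part_fiberPartition.1 (hxmem ⟨(fiberPartition g).part y, _⟩)).symm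

/-- Summation over maps into `Fin M` of a function of the fiber partition. -/
lemma sum_fiberPartition (M : ℕ) (c : Finpartition (Finset.univ : Finset (Fin n)) → ℂ) :
    ∑ g : Fin n → Fin M, c (fiberPartition g) =
      ∑ A : Finpartition (Finset.univ : Finset (Fin n)), (M.descFactorial A.parts.card : ℂ) * c A := by
  classical
  rw [← Finset.sum_fiberwise Finset.univ (fun g : Fin n → Fin M => fiberPartition g)]
  refine Finset.sum_congr rfl fun A _ => ?_
  rw [Finset.sum_congr rfl (g := fun _ => c A) fun g hg => by rw [(Finset.mem_filter.1 hg).2],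
    Finset.sum_const, nsmul_eq_mul]
  congr 2
  -- The falling factorial counts the embeddings of the blocks of `A` into `Fin M`.
  rw [← Fintype.card_subtype, ← Fintype.card_congr (Equiv.ofBijective _ (bijective_comp_part A)),
    Fintype.card_embedding_eq, Fintype.card_fin, Fintype.card_coe]

end Partitions

/-! ### Factorial moments of the Poisson law -/

section Poisson

/-- The bound `M ^ n ≤ n! e ^ M` reduces all moments to the exponential moment. -/
lemma integrable_pow_poissonMeasure (r : NNReal) (n : ℕ) :
    Integrable (fun M : ℕ => (M : ℝ) ^ n) (poissonMeasure r) := by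
  rw [integrable_poissonMeasure_iff]
  have h := (Real.summable_pow_div_factorial (r * Real.exp 1)).mul_left
    (Real.exp (-r) * n.factorial)
  refine Summable.of_nonneg_of_le (fun M => by positivity) (fun M => ?_) h
  have h1 := Real.pow_div_factorial_le_exp (M : ℝ) (Nat.cast_nonneg M) n
  rw [div_le_iff₀ (by positivity)] at h1
  rw [Real.norm_of_nonneg (by positivity), mul_pow, ← Real.exp_nat_mul, mul_one]
  calc _ ≤ Real.exp (-r) * r ^ M / M.factorial * (Real.exp M * n.factorial) :=
        mul_le_mul_of_nonneg_left h1 (by positivity)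
    _ = _ := by ring

lemma integrable_descFactorial_poissonMeasure (r : NNReal) (j : ℕ) :
    Integrable (fun M : ℕ => (M.descFactorial j : ℂ)) (poissonMeasure r) := by
  refine (integrable_pow_poissonMeasure r j).mono' (by fun_prop)
    (Filter.Eventually.of_forall fun M => ?_)
  rw [Complex.norm_natCast]
  exact_mod_cast Nat.descFactorial_le_pow M j

/-- The factorial moments of the Poisson distribution. -/
lemma integral_descFactorial_poissonMeasure (r : NNReal) (j : ℕ) :
    ∫ M : ℕ, (M.descFactorial j : ℂ) ∂poissonMeasure r = (r : ℂ) ^ j := by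
  rw [integral_poissonMeasure]
  refine HasSum.tsum_eq ?_
  -- Terms with `M < j` vanish; after the shift `M = m + j` the series is `r ^ j` times the total
  -- Poisson mass.
  rw [← (add_left_injective j).hasSum_iff]
  · have h := ((hasSum_one_poissonMeasure r).mul_left ((r : ℝ) ^ j))
    have h2 := Complex.hasSum_ofReal.2 h
    convert! h2 using 1
    · ext m
      simp only [Function.comp, Complex.real_smul]
      have hf : ((m + j).factorial : ℝ) = m.factorial * ((m + j).descFactorial j : ℕ) := by
        have h := Nat.factorial_mul_descFactorial (Nat.le_add_left j m)
        rw [Nat.add_sub_cancel] at h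
        exact_mod_cast h.symm
      have h1 : (m.factorial : ℝ) ≠ 0 := by positivity
      have h2 : ((m + j).descFactorial j : ℝ) ≠ 0 := by
        intro h0
        rw [h0, mul_zero] at hf
        exact (Nat.cast_ne_zero.2 (m + j).factorial_ne_zero) hf
      rw [← Complex.ofReal_natCast, ← Complex.ofReal_mul, hf]
      congr 1
      field_simp
      ring
    · simp
  · intro M hM
    have : M < j := by
      by_contra hc
      exact hM ⟨M - j, Nat.sub_add_cancel (not_lt.1 hc)⟩
    simp [Nat.descFactorial_of_lt this]

end Poisson

/-! ### Expectation over positions and weights -/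

/-- The uniform distribution on the box. -/
abbrev positionLaw (d : ℕ) (L : ℝ) : Measure (E d) :=
  ProbabilityTheory.cond (volume : Measure (E d)) (box d L)

lemma isProbabilityMeasure_positionLaw (d : ℕ) {L : ℝ} (hL : 0 < L) :
    IsProbabilityMeasure (positionLaw d L) := by
  refine cond_isProbabilityMeasure_of_finite ?_ (volume_box_lt_top d L).ne
  intro h
  have := boxVol_pos d hL
  rw [boxVol, Measure.real, h] at this
  simp at this

/-- The joint law of the positions and weights of the impurities. -/
abbrev marksLaw (d : ℕ) (L : ℝ) (Pv : Measure ℝ) : Measure ((ℕ → E d) × (ℕ → ℝ)) :=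
  (Measure.infinitePi fun _ : ℕ => positionLaw d L).prod (Measure.infinitePi fun _ : ℕ => Pv)

open Classical in
lemma integral_expo_positionLaw {d : ℕ} {L : ℝ} (hL : 0 < L) {p : E d} (hp : p ∈ dualLattice d L) :
    ∫ y, expo p y ∂positionLaw d L = if p = 0 then 1 else 0 := by
  rw [positionLaw, ProbabilityTheory.cond, integral_smul_measure, setIntegral_expo hL hp,
    ENNReal.toReal_inv]
  have hv : (volume (box d L)).toReal = boxVol d L := rfl
  have h0 : (boxVol d L : ℂ) ≠ 0 := by exact_mod_cast (boxVol_pos d hL).ne'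
  rw [hv]
  split_ifs
  · rw [Complex.real_smul, Complex.ofReal_inv, inv_mul_cancel₀ h0]
  · simp

lemma integral_infinitePi_prod {X : Type*} [MeasurableSpace X] (μ : Measure X)
    [IsProbabilityMeasure μ] (s : Finset ℕ) {F : ℕ → X → ℂ} (hF : ∀ i, Measurable (F i)) :
    ∫ x, ∏ i ∈ s, F i (x i) ∂(Measure.infinitePi fun _ : ℕ => μ) = ∏ i ∈ s, ∫ x, F i x ∂μ := by
  have hind := (iIndepFun_infinitePi (P := fun _ : ℕ => μ) hF).precomp
    (g := fun i : s => (i : ℕ)) Subtype.val_injective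
  have hmp := fun i : ℕ => measurePreserving_eval_infinitePi (fun _ : ℕ => μ) i
  have h := hind.integral_fun_prod_eq_prod_integral fun i =>
    ((hF i).comp (measurable_pi_apply (i : ℕ))).aestronglyMeasurable
  simp only [← Finset.prod_coe_sort s]
  rw [h]
  refine Finset.prod_congr rfl fun i _ => ?_
  have h2 := integral_map (hmp i).measurable.aemeasurable (f := F i)
    (μ := Measure.infinitePi fun _ : ℕ => μ) (hF i).aestronglyMeasurable
  rw [(hmp i).map_eq] at h2
  exact h2.symm

/-- The product of independent identically distributed factors along a map factorizes over its
fibers. -/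
lemma integral_infinitePi_prod_comp {X : Type*} [MeasurableSpace X] (μ : Measure X)
    [IsProbabilityMeasure μ] {n : ℕ} (g : Fin n → ℕ) {f : Fin n → X → ℂ}
    (hf : ∀ l, Measurable (f l)) :
    ∫ x, ∏ l, f l (x (g l)) ∂(Measure.infinitePi fun _ : ℕ => μ) =
      ∏ a ∈ (fiberPartition g).parts, ∫ x, ∏ l ∈ a, f l x ∂μ := by
  rw [prod_parts_fiberPartition, ← integral_infinitePi_prod μ (Finset.univ.image g)
    (F := fun i x => ∏ l ∈ Finset.univ.filter fun l => g l = i, f l x)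
    fun i => Finset.measurable_prod _ fun l _ => hf l]
  refine integral_congr_ae (Filter.Eventually.of_forall fun x => ?_)
  simp only
  rw [← Finset.prod_fiberwise_of_maps_to (t := Finset.univ.image g) (g := g)
    fun l _ => Finset.mem_image_of_mem g (Finset.mem_univ l)]
  refine Finset.prod_congr rfl fun i _ => Finset.prod_congr rfl fun l hl => ?_
  rw [(Finset.mem_filter.1 hl).2]

open Classical in
/-- The contribution of a single impurity to a block of momentum transfers. -/
def blockMoment {d n : ℕ} (Pv : Measure ℝ) (u : Fin n → E d) (a : Finset (Fin n)) : ℂ :=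
  (weightMoment Pv a.card : ℂ) * if ∑ l ∈ a, u l = 0 then 1 else 0

lemma sum_mem_dualLattice {d : ℕ} {L : ℝ} {ι : Type*} (a : Finset ι) {u : ι → E d}
    (hu : ∀ l, u l ∈ dualLattice d L) : ∑ l ∈ a, u l ∈ dualLattice d L := by
  classical
  induction a using Finset.induction_on with
  | empty => exact fun j => ⟨0, by simp⟩
  | insert x s hx ih =>
    rw [Finset.sum_insert hx]
    exact add_mem_dualLattice (hu x) ih

lemma prod_expo {d : ℕ} {ι : Type*} (a : Finset ι) (u : ι → E d) (y : E d) :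
    ∏ l ∈ a, expo (u l) y = expo (∑ l ∈ a, u l) y := by
  classical
  induction a using Finset.induction_on with
  | empty => simp [expo_zero]
  | insert x s hx ih => rw [Finset.prod_insert hx, Finset.sum_insert hx, expo_add, ih]

/-- The expectation over positions and weights for a fixed assignment of impurities. -/
lemma integral_marksLaw_prod {d : ℕ} {L : ℝ} (hL : 0 < L) (Pv : Measure ℝ) [IsProbabilityMeasure Pv]
    {n : ℕ} (g : Fin n → ℕ) {u : Fin n → E d} (hu : ∀ l, u l ∈ dualLattice d L) :
    ∫ q, ∏ l, ((q.2 (g l) : ℂ) * expo (-u l) (q.1 (g l))) ∂marksLaw d L Pv =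
      ∏ a ∈ (fiberPartition g).parts, blockMoment Pv u a := by
  have := isProbabilityMeasure_positionLaw d hL
  have hsplit : ∀ q : (ℕ → E d) × (ℕ → ℝ), ∏ l, ((q.2 (g l) : ℂ) * expo (-u l) (q.1 (g l))) =
      (∏ l, expo (-u l) (q.1 (g l))) * ∏ l, (q.2 (g l) : ℂ) := fun q => by
    rw [Finset.prod_mul_distrib, mul_comm]
  simp only [hsplit]
  rw [integral_prod_mul (fun y : ℕ → E d => ∏ l, expo (-u l) (y (g l)))
      (fun v : ℕ → ℝ => ∏ l, (v (g l) : ℂ)),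
    integral_infinitePi_prod_comp (positionLaw d L) g (f := fun l y => expo (-u l) y)
      fun l => (continuous_expo _).measurable,
    integral_infinitePi_prod_comp Pv g (f := fun _ v => (v : ℂ))
      fun l => Complex.continuous_ofReal.measurable, ← Finset.prod_mul_distrib]
  refine Finset.prod_congr rfl fun a _ => ?_
  have h1 : ∀ y : E d, ∏ l ∈ a, expo (-u l) y = expo (-∑ l ∈ a, u l) y := fun y => by
    rw [prod_expo, Finset.sum_neg_distrib]
  have h2 : ∀ v : ℝ, ∏ _l ∈ a, (v : ℂ) = ((v ^ a.card : ℝ) : ℂ) := fun v => by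
    rw [Finset.prod_const, Complex.ofReal_pow]
  simp only [h1, h2]
  rw [integral_expo_positionLaw hL (neg_mem_dualLattice (sum_mem_dualLattice a hu)),
    integral_complex_ofReal, blockMoment, weightMoment, mul_comm]
  simp only [neg_eq_zero]

/-! ### Integrability of the powers of the total weight -/

/-- The power mean inequality; it replaces mixed moments of the weights by moments of single
weights. -/
lemma sum_pow_succ_le (n M : ℕ) (v : ℕ → ℝ) :
    (∑ γ ∈ Finset.range M, |v γ|) ^ (n + 1) ≤
      (M : ℝ) ^ n * ∑ γ ∈ Finset.range M, |v γ| ^ (n + 1) := by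
  rcases Nat.eq_zero_or_pos M with rfl | hM
  · simp
  have h := pow_sum_div_card_le_sum_pow (s := Finset.range M) (f := fun γ => |v γ|)
    (fun _ _ => abs_nonneg _) n
  rw [Finset.card_range, div_le_iff₀ (by positivity)] at h
  rwa [mul_comm]

lemma integrable_abs_pow_marksLaw (d : ℕ) {L : ℝ} (hL : 0 < L) (Pv : Measure ℝ)
    [IsProbabilityMeasure Pv] (hPv : ∀ k : ℕ, Integrable (fun v : ℝ => v ^ k) Pv) (k γ : ℕ) :
    Integrable (fun q : (ℕ → E d) × (ℕ → ℝ) => |q.2 γ| ^ k) (marksLaw d L Pv) := by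
  have := isProbabilityMeasure_positionLaw d hL
  have h1 : Integrable (fun v : ℝ => |v| ^ k) Pv := by
    convert (hPv k).abs using 2
    rw [abs_pow]
  have h2 := (measurePreserving_eval_infinitePi (fun _ : ℕ => Pv) γ).integrable_comp_of_integrable h1
  exact h2.comp_snd (Measure.infinitePi fun _ : ℕ => positionLaw d L)

lemma integral_abs_pow_marksLaw (d : ℕ) {L : ℝ} (hL : 0 < L) (Pv : Measure ℝ)
    [IsProbabilityMeasure Pv] (k γ : ℕ) :
    ∫ q, |q.2 γ| ^ k ∂marksLaw d L Pv = ∫ v, |v| ^ k ∂Pv := by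
  have := isProbabilityMeasure_positionLaw d hL
  have h := integral_fun_snd (μ := Measure.infinitePi fun _ : ℕ => positionLaw d L)
    (ν := Measure.infinitePi fun _ : ℕ => Pv) (fun v : ℕ → ℝ => |v γ| ^ k)
  have hmp := measurePreserving_eval_infinitePi (fun _ : ℕ => Pv) γ
  have h2 := integral_map hmp.measurable.aemeasurable (f := fun v : ℝ => |v| ^ k)
    (μ := Measure.infinitePi fun _ : ℕ => Pv) (by fun_prop)
  rw [hmp.map_eq] at h2
  rw [h, h2]
  simp

lemma configLaw_eq (d : ℕ) (L : ℝ) (Pv : Measure ℝ) :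
    configLaw d L Pv = (poissonMeasure (boxVol d L).toNNReal).prod (marksLaw d L Pv) := rfl

lemma isProbabilityMeasure_configLaw (d : ℕ) {L : ℝ} (hL : 0 < L) (Pv : Measure ℝ)
    [IsProbabilityMeasure Pv] : IsProbabilityMeasure (configLaw d L Pv) := by
  have := isProbabilityMeasure_positionLaw d hL
  rw [configLaw_eq]
  infer_instance

/-- The first component is countable, so it suffices to fix `M`, for which the sum has a fixed
range. -/
lemma measurable_totalWeight (d : ℕ) : Measurable (totalWeight (d := d)) := by
  refine measurable_from_prod_countable_right fun M => ?_
  simp only [totalWeight]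
  fun_prop

/-- The powers of the total variation of the random measure are integrable. -/
lemma integrable_totalWeight_pow (d : ℕ) {L : ℝ} (hL : 0 < L) (Pv : Measure ℝ)
    [IsProbabilityMeasure Pv] (hPv : ∀ k : ℕ, Integrable (fun v : ℝ => v ^ k) Pv) (n : ℕ) :
    Integrable (fun ω : Config d => totalWeight ω ^ n) (configLaw d L Pv) := by
  have := isProbabilityMeasure_positionLaw d hL
  have := isProbabilityMeasure_configLaw d hL Pv
  rcases n with - | n
  · simp
  have hdom : Integrable (fun ω : Config d =>
      (ω.1 : ℝ) ^ n * ∑ γ ∈ Finset.range ω.1, |ω.2.2 γ| ^ (n + 1)) (configLaw d L Pv) := by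
    have hmeas : Measurable fun ω : Config d =>
        (ω.1 : ℝ) ^ n * ∑ γ ∈ Finset.range ω.1, |ω.2.2 γ| ^ (n + 1) := by
      refine measurable_from_prod_countable_right fun M => ?_
      simp only
      fun_prop
    have hslice : ∀ M : ℕ, Integrable (fun q : (ℕ → E d) × (ℕ → ℝ) =>
        (M : ℝ) ^ n * ∑ γ ∈ Finset.range M, |q.2 γ| ^ (n + 1)) (marksLaw d L Pv) := fun M =>
      (integrable_finsetSum _ fun γ _ =>
        integrable_abs_pow_marksLaw d hL Pv hPv (n + 1) γ).const_mul _
    rw [configLaw_eq, integrable_prod_iff hmeas.aestronglyMeasurable]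
    refine ⟨Filter.Eventually.of_forall hslice, ?_⟩
    -- Integrating out the marks leaves `M ^ (n + 1)` times a constant, which has finite Poisson
    -- mean.
    have hnorm : ∀ M : ℕ, ∫ q : (ℕ → E d) × (ℕ → ℝ),
        ‖(M : ℝ) ^ n * ∑ γ ∈ Finset.range M, |q.2 γ| ^ (n + 1)‖ ∂marksLaw d L Pv =
          (M : ℝ) ^ (n + 1) * ∫ v, |v| ^ (n + 1) ∂Pv := by
      intro M
      have hpos : ∀ q : (ℕ → E d) × (ℕ → ℝ),
          ‖(M : ℝ) ^ n * ∑ γ ∈ Finset.range M, |q.2 γ| ^ (n + 1)‖ =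
            (M : ℝ) ^ n * ∑ γ ∈ Finset.range M, |q.2 γ| ^ (n + 1) := fun q =>
        Real.norm_of_nonneg (mul_nonneg (by positivity) (Finset.sum_nonneg fun γ _ => by positivity))
      simp only [hpos]
      rw [integral_const_mul, integral_finsetSum _ fun γ _ =>
        integrable_abs_pow_marksLaw d hL Pv hPv (n + 1) γ]
      simp only [integral_abs_pow_marksLaw d hL Pv, Finset.sum_const, Finset.card_range,
        nsmul_eq_mul]
      ring
    simp only [hnorm]
    exact (integrable_pow_poissonMeasure _ (n + 1)).mul_const _
  refine hdom.mono' ((measurable_totalWeight d).pow_const _).aestronglyMeasurable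
    (Filter.Eventually.of_forall fun ω => ?_)
  rw [Real.norm_of_nonneg (pow_nonneg (totalWeight_nonneg ω) _)]
  exact sum_pow_succ_le n ω.1 ω.2.2

/-! ### Correlations of structure factors -/

lemma measurable_structureFactor {d : ℕ} (p : E d) :
    Measurable fun ω : Config d => structureFactor ω p := by
  refine measurable_from_prod_countable_right fun M => ?_
  simp only [structureFactor, expo]
  fun_prop

/-- The correlation functions of the structure factor of the marked Poisson process. -/
lemma integral_prod_structureFactor {d : ℕ} {L : ℝ} (hL : 0 < L) (Pv : Measure ℝ)
    [IsProbabilityMeasure Pv] (hPv : ∀ k : ℕ, Integrable (fun v : ℝ => v ^ k) Pv) {n : ℕ}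
    {u : Fin n → E d} (hu : ∀ l, u l ∈ dualLattice d L) :
    Integrable (fun ω : Config d => ∏ l, structureFactor ω (u l)) (configLaw d L Pv) ∧
    ∫ ω : Config d, ∏ l, structureFactor ω (u l) ∂configLaw d L Pv =
      ∑ A : Finpartition (Finset.univ : Finset (Fin n)),
        (boxVol d L : ℂ) ^ A.parts.card * ∏ a ∈ A.parts, blockMoment Pv u a := by
  have := isProbabilityMeasure_positionLaw d hL
  have hint : Integrable (fun ω : Config d => ∏ l, structureFactor ω (u l)) (configLaw d L Pv) := by
    refine (integrable_totalWeight_pow d hL Pv hPv n).mono'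
      (Finset.measurable_prod _ fun l _ => measurable_structureFactor _).aestronglyMeasurable
      (Filter.Eventually.of_forall fun ω => ?_)
    rw [norm_prod]
    refine (Finset.prod_le_prod (fun _ _ => norm_nonneg _)
      fun l _ => norm_structureFactor_le ω _).trans (le_of_eq ?_)
    simp
  refine ⟨hint, ?_⟩
  have hslice : ∀ M : ℕ, ∫ q, ∏ l, structureFactor (M, q) (u l) ∂marksLaw d L Pv =
      ∑ A : Finpartition (Finset.univ : Finset (Fin n)),
        (M.descFactorial A.parts.card : ℂ) * ∏ a ∈ A.parts, blockMoment Pv u a := by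
    intro M
    -- The map `g` assigns an impurity to each of the `n` factors.
    have hexpand : ∀ q : (ℕ → E d) × (ℕ → ℝ), ∏ l, structureFactor (M, q) (u l) =
        ∑ g : Fin n → Fin M, ∏ l, ((q.2 (g l) : ℂ) * expo (-u l) (q.1 (g l))) := by
      intro q
      simp only [structureFactor]
      simp only [Finset.sum_range]
      rw [Finset.prod_univ_sum, Fintype.piFinset_univ]
    simp only [hexpand]
    rw [integral_finsetSum, ← sum_fiberPartition]
    · refine Finset.sum_congr rfl fun g _ => ?_
      rw [integral_marksLaw_prod hL Pv (fun l => (g l : ℕ)) hu]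
      -- Fibers are unchanged when the values in `Fin M` are read as natural numbers.
      congr 2
      refine finpartition_ext fun x => ?_
      ext y
      rw [mem_part_fiberPartition, mem_part_fiberPartition, Fin.val_inj]
    · intro g _
      -- A product of `n` factors is at most the `n`-th power of the largest; the summand `1` covers
      -- the empty product at `n = 0`.
      have hdom : Integrable (fun q : (ℕ → E d) × (ℕ → ℝ) =>
          ∑ l : Fin n, |q.2 (g l)| ^ n + 1) (marksLaw d L Pv) :=
        (integrable_finsetSum _ fun l _ =>
          integrable_abs_pow_marksLaw d hL Pv hPv n (g l)).add (integrable_const _)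
      refine hdom.mono' ?_ (Filter.Eventually.of_forall fun q => ?_)
      · refine Measurable.aestronglyMeasurable ?_
        unfold expo
        fun_prop
      · rw [norm_prod]
        simp only [norm_mul, norm_expo, mul_one, Complex.norm_real, Real.norm_eq_abs]
        rcases Nat.eq_zero_or_pos n with rfl | hn
        · simp
        obtain ⟨m, -, hm⟩ := Finset.exists_max_image Finset.univ (fun l => |q.2 (g l)|)
          ⟨⟨0, hn⟩, Finset.mem_univ _⟩
        calc ∏ l, |q.2 (g l)| ≤ ∏ _l : Fin n, |q.2 (g m)| :=
              Finset.prod_le_prod (fun _ _ => abs_nonneg _) fun l _ => hm l (Finset.mem_univ l)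
          _ = |q.2 (g m)| ^ n := by simp
          _ ≤ ∑ l, |q.2 (g l)| ^ n := Finset.single_le_sum
              (f := fun l => |q.2 (g l)| ^ n) (fun _ _ => by positivity) (Finset.mem_univ m)
          _ ≤ _ := by linarith
  rw [configLaw_eq] at hint ⊢
  rw [integral_prod _ hint]
  simp only [hslice]
  rw [integral_finsetSum _ fun A _ => (integrable_descFactorial_poissonMeasure _ _).mul_const _]
  refine Finset.sum_congr rfl fun A _ => ?_
  rw [integral_mul_const, integral_descFactorial_poissonMeasure, Real.coe_toNNReal']
  rw [max_eq_left (boxVol_pos d hL).le]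

/-! ### Identification of the integrand and conclusion -/

lemma coeFn_periodizeL2 {d : ℕ} (L : ℝ) (ψ : Lp ℂ 2 (volume : Measure (E d))) :
    periodizeL2 L ψ =ᵐ[boxMeasure d L] periodize L ψ := (memLp_periodize L ψ).coeFn_toLp

/-- The successive differences of a chain of lattice momenta. -/
def momentumTransfer {d : ℕ} {L : ℝ} {n : ℕ} (k : Fin (n + 1) → dualLattice d L) (l : Fin n) : E d :=
  (k l.castSucc : E d) - (k l.succ : E d)

lemma momentumTransfer_mem {d : ℕ} {L : ℝ} {n : ℕ} (k : Fin (n + 1) → dualLattice d L) (l : Fin n) :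
    momentumTransfer k l ∈ dualLattice d L := sub_mem_dualLattice (k _).2 (k _).2

/-- The expected product of structure factors along a chain of momenta. -/
def meanStructureProd {d : ℕ} {L : ℝ} (Pv : Measure ℝ) {n : ℕ}
    (k : Fin (n + 1) → dualLattice d L) : ℂ :=
  ∑ A : Finpartition (Finset.univ : Finset (Fin n)),
    (boxVol d L : ℂ) ^ A.parts.card * ∏ a ∈ A.parts, blockMoment Pv (momentumTransfer k) a

lemma integrable_structureProd {d : ℕ} {L : ℝ} (hL : 0 < L) (Pv : Measure ℝ)
    [IsProbabilityMeasure Pv] (hPv : ∀ k : ℕ, Integrable (fun v : ℝ => v ^ k) Pv) {n : ℕ}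
    (k : Fin (n + 1) → dualLattice d L) :
    Integrable (fun ω => structureProd ω k) (configLaw d L Pv) :=
  (integral_prod_structureFactor hL Pv hPv (momentumTransfer_mem k)).1

lemma integral_structureProd {d : ℕ} {L : ℝ} (hL : 0 < L) (Pv : Measure ℝ)
    [IsProbabilityMeasure Pv] (hPv : ∀ k : ℕ, Integrable (fun v : ℝ => v ^ k) Pv) {n : ℕ}
    (k : Fin (n + 1) → dualLattice d L) :
    ∫ ω, structureProd ω k ∂configLaw d L Pv = meanStructureProd Pv k :=
  (integral_prod_structureFactor hL Pv hPv (momentumTransfer_mem k)).2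

lemma sum_partitionFunction {d : ℕ} {L : ℝ} (B : 𝓢(E d, ℝ)) (Pv : Measure ℝ) {n : ℕ}
    (k : Fin (n + 1) → dualLattice d L) :
    ∑ A : Finpartition (Finset.univ : Finset (Fin n)), partitionFunction L B Pv A k =
      meanStructureProd Pv k *
        ∏ l : Fin n, profileCoeff L B ((k l.castSucc : E d) - (k l.succ : E d)) := by
  rw [meanStructureProd, Finset.sum_mul]
  refine Finset.sum_congr rfl fun A _ => ?_
  have hprod : ∏ l : Fin n, profileCoeff L B ((k l.castSucc : E d) - (k l.succ : E d)) =
      ∏ a ∈ A.parts, ∏ l ∈ a, profileCoeff L B ((k l.castSucc : E d) - (k l.succ : E d)) := by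
    conv_lhs => rw [← A.biUnion_parts]
    rw [Finset.prod_biUnion A.disjoint]
    rfl
  -- The power `|Λ_L|^|A|` is distributed over the blocks, one factor each, and becomes the
  -- normalization of `deltaL`.
  rw [partitionFunction, hprod, ← Finset.prod_const, ← Finset.prod_mul_distrib,
    ← Finset.prod_mul_distrib]
  refine Finset.prod_congr rfl fun a _ => ?_
  change (weightMoment Pv a.card : ℂ) * (deltaL L (∑ l ∈ a, momentumTransfer k l) : ℂ) * _ = _
  rw [deltaL, blockMoment]
  by_cases h : ∑ l ∈ a, momentumTransfer k l = 0
  · rw [if_pos h, if_pos h]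
    ring
  · rw [if_neg h, if_neg h]
    simp

lemma momentumIntegrand_eq {d : ℕ} (L : ℝ) (B : 𝓢(E d, ℝ)) (Pv : Measure ℝ) (n : ℕ) (z : ℂ)
    (ψ₁ ψ₂ : Lp ℂ 2 (volume : Measure (E d))) (k : Fin (n + 1) → dualLattice d L) :
    momentumIntegrand L B Pv n z ψ₁ ψ₂ k =
      chainTerm B z (periodizeL2 L ψ₁) (periodizeL2 L ψ₂) k * meanStructureProd Pv k := by
  rw [momentumIntegrand, sum_partitionFunction, chainTerm,
    fourierCoeff_congr (coeFn_periodizeL2 L ψ₁), fourierCoeff_congr (coeFn_periodizeL2 L ψ₂)]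
  ring

/-- A bound uniform in `k`, obtained from the expectation and not from the sum over partitions. -/
lemma norm_meanStructureProd_le {d : ℕ} {L : ℝ} (hL : 0 < L) (Pv : Measure ℝ)
    [IsProbabilityMeasure Pv] (hPv : ∀ k : ℕ, Integrable (fun v : ℝ => v ^ k) Pv) (n : ℕ)
    (k : Fin (n + 1) → dualLattice d L) :
    ‖meanStructureProd Pv k‖ ≤ ∫ ω : Config d, totalWeight ω ^ n ∂configLaw d L Pv := by
  rw [← integral_structureProd hL Pv hPv k]
  exact norm_integral_le_of_norm_le (integrable_totalWeight_pow d hL Pv hPv n)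
    (Filter.Eventually.of_forall fun ω => norm_structureProd_le ω k)

end PoissonSchrodinger
end

theorem theorem2p2 (d : ℕ) (L : ℝ) (hL : 0 < L)
    (B : 𝓢(PoissonSchrodinger.E d, ℝ))
    (hB : HasCompactSupport B ∨ ∀ (j : Fin d) (x : PoissonSchrodinger.E d),
      B (PoissonSchrodinger.reflect j x) = B x)
    (Pv : Measure ℝ) [IsProbabilityMeasure Pv]
    (hPv : ∀ k : ℕ, Integrable (fun v : ℝ => v ^ k) Pv)
    (n : ℕ) (z : ℂ) (hz : ∀ t : ℝ, 0 ≤ t → z ≠ (t : ℂ))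
    (ψ₁ ψ₂ : Lp ℂ 2 (volume : Measure (PoissonSchrodinger.E d))) :
    Integrable (PoissonSchrodinger.matrixElement L B n z ψ₁ ψ₂)
        (PoissonSchrodinger.configLaw d L Pv) ∧
      Summable (PoissonSchrodinger.momentumIntegrand L B Pv n z ψ₁ ψ₂) ∧
      PoissonSchrodinger.expansionCoeff L B Pv n z ψ₁ ψ₂ =
        PoissonSchrodinger.latticeIntegral L
          (PoissonSchrodinger.momentumIntegrand L B Pv n z ψ₁ ψ₂) := by
  open PoissonSchrodinger in
  -- Countability makes the momentum sum measurable in `ω` and permits termwise integration.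
  have : Countable (dualLattice d L) := countable_dualLattice d hL
  have hchain := summable_norm_chainTerm hL B n hz (periodizeL2 L ψ₁) (periodizeL2 L ψ₂)
  have hW := integrable_totalWeight_pow d hL Pv hPv n
  have hterm : ∀ k : Fin (n + 1) → dualLattice d L, Integrable (fun ω : Config d =>
      chainTerm B z (periodizeL2 L ψ₁) (periodizeL2 L ψ₂) k * structureProd ω k)
      (configLaw d L Pv) := fun k => (integrable_structureProd hL Pv hPv k).const_mul _
  have hmat : matrixElement L B n z ψ₁ ψ₂ = fun ω => ((boxVol d L : ℂ)⁻¹) ^ (n + 1) *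
      ∑' k : Fin (n + 1) → dualLattice d L,
        chainTerm B z (periodizeL2 L ψ₁) (periodizeL2 L ψ₂) k * structureProd ω k :=
    funext fun ω => inner_freeResolvent_iterate hL B n hz _ _ ω
  have hnorm : ∀ (k : Fin (n + 1) → dualLattice d L) (ω : Config d),
      ‖chainTerm B z (periodizeL2 L ψ₁) (periodizeL2 L ψ₂) k * structureProd ω k‖ ≤
        ‖chainTerm B z (periodizeL2 L ψ₁) (periodizeL2 L ψ₂) k‖ * totalWeight ω ^ n :=
    fun k ω => by
      rw [norm_mul]
      exact mul_le_mul_of_nonneg_left (norm_structureProd_le ω k) (norm_nonneg _)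
  refine ⟨?_, ?_, ?_⟩
  · rw [hmat]
    refine Integrable.const_mul ?_ _
    refine (hW.const_mul (∑' k : Fin (n + 1) → dualLattice d L,
      ‖chainTerm B z (periodizeL2 L ψ₁) (periodizeL2 L ψ₂) k‖)).mono'
      (AEStronglyMeasurable.tsum fun k => (hterm k).aestronglyMeasurable)
      (Filter.Eventually.of_forall fun ω => ?_)
    exact tsum_of_norm_bounded (hchain.hasSum.mul_right _) fun k => hnorm k ω
  · refine Summable.of_norm_bounded
      (hchain.mul_right (∫ ω : Config d, totalWeight ω ^ n ∂configLaw d L Pv)) fun k => ?_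
    rw [momentumIntegrand_eq, norm_mul]
    exact mul_le_mul_of_nonneg_left (norm_meanStructureProd_le hL Pv hPv n k) (norm_nonneg _)
  -- Summability of the expected norms is the hypothesis under which sum and expectation commute.
  · have hsum : Summable fun k : Fin (n + 1) → dualLattice d L => ∫ ω,
        ‖chainTerm B z (periodizeL2 L ψ₁) (periodizeL2 L ψ₂) k * structureProd ω k‖
          ∂configLaw d L Pv := by
      refine Summable.of_nonneg_of_le (fun k => integral_nonneg fun ω => norm_nonneg _) (fun k => ?_)
        (hchain.mul_right (∫ ω : Config d, totalWeight ω ^ n ∂configLaw d L Pv))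
      rw [← integral_const_mul]
      exact integral_mono (hterm k).norm (hW.const_mul _) (hnorm k)
    rw [expansionCoeff, hmat, integral_const_mul, latticeIntegral,
      ← (hasSum_integral_of_summable_integral_norm hterm hsum).tsum_eq]
    congr 1
    refine tsum_congr fun k => ?_
    rw [integral_const_mul, integral_structureProd hL Pv hPv, momentumIntegrand_eq]
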